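/- Let $P$ be a finite poset with least element $0$. For $A\subseteq P$ let $A^{\ell}$ and $A^{u}$ denote the sets of lower and of upper bounds of $A$ in $P$. The zero-divisor graph $G(P)$ is the simple graph whose vertices are the elements $a\in P\setminus\{0\}$ for which there is $b\in P\setminus\{0\}$ with $\{a,b\}^{\ell}=\{0\}$, two vertices $a,b$ being adjacent if and only if $\{a,b\}^{\ell}=\{0\}$; let $G^c(P)$ be its complement on the same vertex set. For a finite simple graph $G$ let $\Delta(G)$ be its maximum degree ($0$ if $G$ has no vertices) and let $\chi''(G)$ be its total chromatic number, the least number of colors in a coloring of the vertices and edges of $G$ such that adjacent vertices, distinct edges with a common endpoint, and each edge and its endpoints receive different colors. Say that $G$ satisfies the Total Coloring Conjecture if $\chi''(G)\le\Delta(G)+2$ and, when $G$ has at least one vertex, $\chi''(G)\in\{\Delta(G)+1,\Delta(G)+2\}$. Then $G(P)$ satisfies the Total Coloring Conjecture. If moreover $P$ is $0$-distributive, that is, for all $a,b,c\in P$, $\{a,b\}^{\ell}=\{0\}=\{a,c\}^{\ell}$ implies $(\{a\}\cup\{b,c\}^{u})^{\ell}=\{0\}$, then $G^c(P)$ also satisfies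 the Total Coloring Conjecture. -/

import Mathlib

namespace SimpleGraph

/-- A total coloring of `G` with colors in `C`: vertices and edges are colored so that
adjacent vertices, distinct edges with a common endpoint, and every edge and each of its
endpoints receive different colors. -/
structure TotalColoring {V : Type*} (G : SimpleGraph V) (C : Type*) where
  /-- the color of a vertex -/
  vertexColor : V → C
  /-- the color of an edge -/
  edgeColor : G.edgeSet → C
  vertex_ne : ∀ v w : V, G.Adj v w → vertexColor v ≠ vertexColor w
  edge_ne : ∀ e f : G.edgeSet, e ≠ f →
    (∃ v : V, v ∈ (e : Sym2 V) ∧ v ∈ (f : Sym2 V)) → edgeColor e ≠ edgeColor f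
  vertex_ne_edge : ∀ (v : V) (e : G.edgeSet), v ∈ (e : Sym2 V) → vertexColor v ≠ edgeColor e

/-- `G` has a total coloring with (at most) `n` colors. -/
def TotalColorable {V : Type*} (G : SimpleGraph V) (n : ℕ) : Prop :=
  Nonempty (G.TotalColoring (Fin n))

/-- The total chromatic number `χ''(G)`: the least number of colors in a total coloring
(`⊤` if no finite number suffices). -/
noncomputable def totalChromaticNumber {V : Type*} (G : SimpleGraph V) : ℕ∞ :=
  ⨅ n ∈ {n : ℕ | G.TotalColorable n}, (n : ℕ∞)

open Classical in
/-- The maximum degree `Δ(G)` of a finite graph. -/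
noncomputable def finiteMaxDegree {V : Type*} [Finite V] (G : SimpleGraph V) : ℕ :=
  letI : Fintype V := Fintype.ofFinite V
  G.maxDegree

/-- The finite graph `G` satisfies the Total Coloring Conjecture: `χ''(G) ≤ Δ(G) + 2`, and
`χ''(G)` is `Δ(G) + 1` or `Δ(G) + 2` as soon as `G` has a vertex (the graph without vertices
has `χ'' = Δ = 0`). -/
def SatisfiesTotalColoringConjecture {V : Type*} [Finite V] (G : SimpleGraph V) : Prop :=
  G.totalChromaticNumber ≤ (G.finiteMaxDegree : ℕ∞) + 2 ∧
    (Nonempty V →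
      G.totalChromaticNumber = (G.finiteMaxDegree : ℕ∞) + 1 ∨
        G.totalChromaticNumber = (G.finiteMaxDegree : ℕ∞) + 2)

end SimpleGraph

namespace PosetZeroDivisor

/-- The set `Z(P)` of zero-divisors: those `a` for which `{a, b}^ℓ = {0}` for some `b ≠ 0`. -/
def zeroDivisors (P : Type*) [PartialOrder P] [OrderBot P] : Set P :=
  {a | ∃ b : P, b ≠ ⊥ ∧ lowerBounds {a, b} = {⊥}}

/-- The vertices of the zero-divisor graph: the nonzero zero-divisors. -/
abbrev Vertex (P : Type*) [PartialOrder P] [OrderBot P] : Type _ :=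
  {a : P // a ∈ zeroDivisors P \ {⊥}}

/-- The zero-divisor graph `G(P)`: nonzero zero-divisors `a`, `b` are adjacent if and only if
`{a, b}^ℓ = {0}`. -/
def zeroDivisorGraph (P : Type*) [PartialOrder P] [OrderBot P] : SimpleGraph (Vertex P) where
  Adj a b := lowerBounds {(a : P), (b : P)} = {⊥}
  symm := ⟨fun a b h => by
    rw [Set.pair_comm]
    exact h⟩
  loopless := ⟨fun a h => by
    have ha : (a : P) ∈ lowerBounds {(a : P), (a : P)} := by simp [lowerBounds]
    rw [h] at ha
    exact a.2.2 ha⟩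

/-- `P` is `0`-distributive: `{a, b}^ℓ = {0} = {a, c}^ℓ` implies `({a} ∪ {b, c}^u)^ℓ = {0}`. -/
def ZeroDistributive (P : Type*) [PartialOrder P] [OrderBot P] : Prop :=
  ∀ a b c : P, lowerBounds {a, b} = {⊥} → lowerBounds {a, c} = {⊥} →
    lowerBounds ({a} ∪ upperBounds {b, c}) = {⊥}

end PosetZeroDivisor

/-! A vertex of maximum degree and its edges need `Δ + 1` colors, so only the upper bound `Δ + 2` is
at stake. The tool for it is the Vizing–Fournier theorem applied to a cone: join a new apex to the
vertices still lacking a color, edge color the result, and let each such vertex take the color of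
its edge to the apex. Colors spent beforehand on independent sets of vertices together with
matchings reduce the degrees of the cone.

Every nonzero element of a finite poset lies above an atom, so both graphs depend only on the sets
of atoms below the vertices: disjointness is adjacency in `G(P)`, intersection is adjacency in the
complement.

For `G(P)` fix an atom `a`. The vertices above `a` are independent, and the others are exactly the
neighbors of `a`, hence at most `Δ` in number. One color serves the independent set and a maximal
matching among the outside vertices of degree `Δ`; the cone then needs only `Δ + 1` more
(`totalColorable_of_independent`).

For the complement, `0`-distributivity makes every set "all atoms but one" occur. Let `p` be the
least number of vertices with the same singleton atom set, attained at the atom `i`. A vertex above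
all atoms except `i` misses only these `p` vertices, so `|V| ≤ Δ + 1 + p`, and `|V| + 1 - p` colors
suffice. With at least three atoms and `p ≥ 2`, two singleton classes yield `p` disjoint nonadjacent
pairs. Each pair shares its color with a matching covering the clique of "all but one" vertices; the
remaining degrees suit a cone with `|V| + 1 - 2p` colors (`totalColorable_of_clique`). If `p = 1`,
one nonadjacent pair suffices as independent set; two atoms give two disjoint cliques, colored by
addition modulo an odd number. -/

namespace SimpleGraph

/-! ### Edge colorings and Kempe exchanges -/

/-- `c` is a proper coloring of the edges of `G` with colors in `K`; the color of the edge
`ab` is `c a b`. -/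
structure IsEdgeColoring {V α : Type*} (G : SimpleGraph V) (K : Finset α) (c : V → V → α) :
    Prop where
  mem : ∀ a b, G.Adj a b → c a b ∈ K
  symm : ∀ a b, G.Adj a b → c a b = c b a
  inj : ∀ a b b', G.Adj a b → G.Adj a b' → c a b = c a b' → b = b'

/-- No edge at `u` has color `i`. -/
def MissesColor {V α : Type*} (G : SimpleGraph V) (c : V → V → α) (u : V) (i : α) : Prop :=
  ∀ b, G.Adj u b → c u b ≠ i

/-- The subgraph of edges with color `i` or `j`. -/
def kempeGraph {V α : Type*} (G : SimpleGraph V) (c : V → V → α) (i j : α) : SimpleGraph V where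
  -- Both orders are constrained, so that the relation is symmetric even for a `c` that is not.
  Adj a b := G.Adj a b ∧ (c a b = i ∨ c a b = j) ∧ (c b a = i ∨ c b a = j)
  symm := ⟨fun _ _ h => ⟨h.1.symm, h.2.2, h.2.1⟩⟩
  loopless := ⟨fun _ h => G.irrefl h.1⟩

open Classical in
/-- In a graph of maximum degree two, a component has at most two vertices of degree at most
one. -/
theorem card_le_two_of_degree_le_one {V : Type*} [Fintype V] (H : SimpleGraph V)
    (h2 : ∀ v, H.degree v ≤ 2) (C : H.ConnectedComponent) (X : Finset V)
    (hXC : ∀ v ∈ X, H.connectedComponentMk v = C) (hX : ∀ v ∈ X, H.degree v ≤ 1) :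
    X.card ≤ 2 := by
  have hdeg : ∀ v : C, C.toSimpleGraph.degree v ≤ H.degree v := by
    intro v
    rw [← card_neighborFinset_eq_degree, ← card_neighborFinset_eq_degree]
    refine Finset.card_le_card_of_injOn (fun w => (w : V)) ?_ (Subtype.val_injective.injOn)
    intro w hw
    simp only [Finset.mem_coe, mem_neighborFinset] at hw ⊢
    exact hw
  -- With `n` vertices, connectedness makes the degree sum at least `2n - 2`, while the degree
  -- bounds make it at most `2n - |X|`.
  have hconn := C.connected_toSimpleGraph.card_vert_le_card_edgeSet_add_one
  rw [Nat.card_eq_fintype_card, Nat.card_eq_fintype_card, ← edgeFinset_card] at hconn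
  have hsum := C.toSimpleGraph.sum_degrees_eq_twice_card_edges
  let Y : Finset C := Finset.univ.filter (fun v => (v : V) ∈ X)
  have hY : Y.card = X.card := by
    refine Finset.card_bij (fun v _ => (v : V)) ?_ ?_ ?_
    · intro v hv
      simpa [Y] using hv
    · intro v _ w _ h
      exact Subtype.ext h
    · intro v hv
      exact ⟨⟨v, hXC v hv⟩, by simpa [Y] using hv, rfl⟩
  have hle : ∑ v : C, C.toSimpleGraph.degree v + Y.card ≤ 2 * Fintype.card C := by
    have h1 : Y.card = ∑ v : C, if (v : V) ∈ X then 1 else 0 := by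
      simp [Y]
    rw [h1, ← Finset.sum_add_distrib]
    calc _ ≤ ∑ _v : C, 2 := by
          refine Finset.sum_le_sum fun v _ => ?_
          have := hdeg v
          have := h2 v
          split_ifs with h
          · have := hX v h
            omega
          · omega
      _ = _ := by simp [mul_comm]
  omega

open Classical in
theorem IsEdgeColoring.kempeGraph_degree_le_two {V α : Type*} [Fintype V] {G : SimpleGraph V}
    {K : Finset α} {c : V → V → α} (hc : G.IsEdgeColoring K c) (i j : α) (v : V) :
    (G.kempeGraph c i j).degree v ≤ 2 := by
  rw [← card_neighborFinset_eq_degree]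
  refine (Finset.card_le_card_of_injOn (t := {i, j}) (c v) ?_ ?_).trans Finset.card_le_two
  · intro w hw
    simp only [Finset.mem_coe, mem_neighborFinset] at hw
    simpa using hw.2.1
  · intro w hw w' hw' h
    simp only [Finset.mem_coe, mem_neighborFinset] at hw hw'
    exact hc.inj _ _ _ hw.1 hw'.1 h

open Classical in
theorem IsEdgeColoring.kempeGraph_degree_le_one {V α : Type*} [Fintype V] {G : SimpleGraph V}
    {K : Finset α} {c : V → V → α} (hc : G.IsEdgeColoring K c) (i j : α) (v : V)
    (hv : G.MissesColor c v i) : (G.kempeGraph c i j).degree v ≤ 1 := by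
  rw [← card_neighborFinset_eq_degree]
  refine (Finset.card_le_card_of_injOn (t := {j}) (c v) ?_ ?_).trans (by simp)
  · intro w hw
    simp only [Finset.mem_coe, mem_neighborFinset] at hw
    simpa using hw.2.1.resolve_left (hv w hw.1)
  · intro w hw w' hw' h
    simp only [Finset.mem_coe, mem_neighborFinset] at hw hw'
    exact hc.inj _ _ _ hw.1 hw'.1 h

open Classical in
/-- Exchanging the colors `i` and `j` on a union `S` of components of the Kempe graph. -/
theorem IsEdgeColoring.swap {V α : Type*} {G : SimpleGraph V} {K : Finset α}
    {c : V → V → α} (hc : G.IsEdgeColoring K c) {i j : α} (hi : i ∈ K) (hj : j ∈ K) (S : Set V)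
    (hS : ∀ a b, (G.kempeGraph c i j).Adj a b → (a ∈ S ↔ b ∈ S)) (π : V → Equiv.Perm α)
    (hπ : ∀ u, π u = if u ∈ S then Equiv.swap i j else 1) :
    G.IsEdgeColoring K (fun a b => π a (c a b)) := by
  constructor
  · intro a b h
    have := hc.mem a b h
    simp only [hπ]
    split_ifs
    · rw [Equiv.swap_apply_def]
      split_ifs <;> assumption
    · exact this
  · intro a b h
    have hs := hc.symm a b h
    simp only [hπ, ← hs]
    by_cases hk : c a b = i ∨ c a b = j
    · have := hS a b ⟨h, hk, hs ▸ hk⟩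
      simp only [this]
    · push Not at hk
      split_ifs <;> simp [Equiv.swap_apply_of_ne_of_ne hk.1 hk.2]
  · intro a b b' h h' he
    exact hc.inj a b b' h h' ((π a).injective he)

open Classical in
/-- If many more vertices of `N` have `i` on their list `A` of missing colors than `j`, then a
Kempe exchange makes the two numbers more balanced. -/
theorem IsEdgeColoring.exists_balance {V α : Type*} [Fintype V] {G : SimpleGraph V}
    {K : Finset α} {c : V → V → α} (hc : G.IsEdgeColoring K c) (N : Finset V) (A : V → Finset α)
    (hA : ∀ u ∈ N, ∀ i ∈ A u, i ∈ K ∧ G.MissesColor c u i) {i j : α} (hi : i ∈ K) (hj : j ∈ K)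
    (hij : (N.filter (fun u => j ∈ A u)).card + 3 ≤ (N.filter (fun u => i ∈ A u)).card) :
    ∃ (c' : V → V → α) (A' : V → Finset α), G.IsEdgeColoring K c' ∧
      (∀ u ∈ N, ∀ i ∈ A' u, i ∈ K ∧ G.MissesColor c' u i) ∧
      (∀ u, (A' u).card = (A u).card) ∧
      ∑ l ∈ K, (N.filter (fun u => l ∈ A' u)).card ^ 2 <
        ∑ l ∈ K, (N.filter (fun u => l ∈ A u)).card ^ 2 := by
  have hne : i ≠ j := by
    rintro rfl
    omega
  set H := G.kempeGraph c i j with hH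
  let x : α → H.ConnectedComponent → Finset V := fun l C =>
    N.filter (fun u => l ∈ A u ∧ H.connectedComponentMk u = C)
  have hx : ∀ l, (N.filter (fun u => l ∈ A u)).card =
      ∑ C : H.ConnectedComponent, (x l C).card := by
    intro l
    rw [Finset.card_eq_sum_card_fiberwise (f := H.connectedComponentMk) (t := Finset.univ)
      (fun _ _ => by simp)]
    refine Finset.sum_congr rfl fun C _ => ?_
    rw [Finset.filter_filter]
  -- Some component contains more list occurrences of `i` than of `j`, but at most two of `i`: a
  -- vertex missing `i` has degree at most one there. Swapping on it thus moves an excess of one or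
  -- two, less than the total excess of three or more.
  obtain ⟨C, -, hC⟩ := Finset.exists_lt_of_sum_lt (s := Finset.univ)
    (f := fun C => (x j C).card) (g := fun C => (x i C).card) (by
      rw [← hx, ← hx]
      omega)
  have hC2 : (x i C).card ≤ 2 := by
    refine card_le_two_of_degree_le_one H (hc.kempeGraph_degree_le_two i j) C _ ?_ ?_
    · intro v hv
      exact (Finset.mem_filter.1 hv).2.2
    · intro v hv
      obtain ⟨hv1, hv2, -⟩ := Finset.mem_filter.1 hv
      exact hc.kempeGraph_degree_le_one i j v (hA v hv1 i hv2).2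
  let S : Set V := {v | H.connectedComponentMk v = C}
  let π : V → Equiv.Perm α := fun u => if u ∈ S then Equiv.swap i j else 1
  have hS : ∀ a b, H.Adj a b → (a ∈ S ↔ b ∈ S) := by
    intro a b h
    simp only [S, Set.mem_ofPred_eq, ConnectedComponent.connectedComponentMk_eq_of_adj h]
  have hmem : ∀ u l, l ∈ (A u).map (π u).toEmbedding ↔
      (if u ∈ S then Equiv.swap i j l else l) ∈ A u := by
    intro u l
    rw [Finset.mem_map_equiv]
    by_cases h : u ∈ S
    · simp [π, h]
    · simp only [π, if_neg h]
      rfl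
  refine ⟨fun a b => π a (c a b), fun u => (A u).map (π u).toEmbedding,
    hc.swap hi hj S hS π (fun _ => rfl), ?_, fun u => Finset.card_map _, ?_⟩
  · intro u hu l hl
    obtain ⟨l', hl', rfl⟩ := Finset.mem_map.1 hl
    obtain ⟨h1, h2⟩ := hA u hu l' hl'
    refine ⟨?_, fun b hb h => h2 b hb ((π u).injective h)⟩
    change (if u ∈ S then Equiv.swap i j else 1) l' ∈ K
    split_ifs
    · rw [Equiv.swap_apply_def]
      split_ifs <;> assumption
    · exact h1
  · have hj' : j ∈ K.erase i := Finset.mem_erase.2 ⟨hne.symm, hj⟩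
    rw [← Finset.add_sum_erase _ _ hi, ← Finset.add_sum_erase _ _ hj',
      ← Finset.add_sum_erase K _ hi, ← Finset.add_sum_erase _ _ hj', ← add_assoc, ← add_assoc]
    have hrest : ∑ l ∈ (K.erase i).erase j,
          (N.filter (fun u => l ∈ (A u).map (π u).toEmbedding)).card ^ 2 =
        ∑ l ∈ (K.erase i).erase j, (N.filter (fun u => l ∈ A u)).card ^ 2 := by
      refine Finset.sum_congr rfl fun l hl => ?_
      have h1 : l ≠ i := by aesop
      have h2 : l ≠ j := by aesop
      simp only [hmem, Equiv.swap_apply_of_ne_of_ne h1 h2, ite_self]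
    rw [hrest]
    refine Nat.add_lt_add_right ?_ _
    let y : α → Finset V := fun l => N.filter (fun u => l ∈ A u ∧ u ∉ S)
    have hsplit : ∀ l, (N.filter (fun u => l ∈ A u)).card = (x l C).card + (y l).card := by
      intro l
      rw [← Finset.card_filter_add_card_filter_not (s := N.filter (fun u => l ∈ A u))
        (fun u => u ∈ S), Finset.filter_filter, Finset.filter_filter]
      rfl
    have hsplit' : ∀ l, (N.filter (fun u => l ∈ (A u).map (π u).toEmbedding)).card =
        (x (Equiv.swap i j l) C).card + (y l).card := by
      intro l
      rw [← Finset.card_filter_add_card_filter_not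
        (s := N.filter (fun u => l ∈ (A u).map (π u).toEmbedding))
        (fun u => u ∈ S), Finset.filter_filter, Finset.filter_filter]
      congr 2
      · ext u
        simp only [hmem, Finset.mem_filter, x]
        by_cases h : u ∈ S
        · simp [h, show H.connectedComponentMk u = C from h]
        · simp [h, show ¬ H.connectedComponentMk u = C from h]
      · ext u
        simp only [hmem, Finset.mem_filter, y]
        by_cases h : u ∈ S <;> simp [h]
    rw [hsplit', hsplit', hsplit, hsplit, Equiv.swap_apply_left, Equiv.swap_apply_right]
    rw [hsplit, hsplit] at hij
    -- The excess of `i` over `j` is `d + 1` inside the component and `e + 1` outside, so the swap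
    -- lowers the sum of squares by `2(d + 1)(e + 1)`.
    obtain ⟨d, hd⟩ := Nat.exists_eq_add_of_lt hC
    obtain ⟨e, he⟩ : ∃ e, (y i).card = (y j).card + e + 1 :=
      ⟨(y i).card - (y j).card - 1, by omega⟩
    rw [hd, he]
    nlinarith [Nat.zero_le (d * e)]

/-! ### Vizing's recoloring lemma and the Vizing–Fournier theorem -/

open Classical in
/-- **Vizing's recoloring lemma.** If at most `|K|` vertices `N` are given, each of them (with
one possible exception) misses two colors and all of them miss a color, then the edges can be
recolored so that distinct missing colors can be selected at the vertices of `N`. -/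
theorem IsEdgeColoring.exists_injOn_missesColor {V α : Type*} [Fintype V] (G : SimpleGraph V)
    (K : Finset α) (c : V → V → α) (hc : G.IsEdgeColoring K c) (N : Finset V)
    (A : V → Finset α) (hA : ∀ u ∈ N, ∀ i ∈ A u, i ∈ K ∧ G.MissesColor c u i) (u₀ : V)
    (h1 : ∀ u ∈ N, 1 ≤ (A u).card) (h2 : ∀ u ∈ N, u ≠ u₀ → 2 ≤ (A u).card)
    (hN : N.card ≤ K.card) :
    ∃ (c' : V → V → α) (f : V → α), G.IsEdgeColoring K c' ∧ Set.InjOn f N ∧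
      ∀ u ∈ N, f u ∈ K ∧ G.MissesColor c' u (f u) := by
  induction hk : K.card generalizing G K c N A u₀ with
  | zero =>
    obtain rfl : N = ∅ := by
      rw [← Finset.card_eq_zero]
      omega
    exact ⟨c, fun v => c v v, hc, by simp, by simp⟩
  | succ k ih =>
  rcases N.eq_empty_or_nonempty with rfl | ⟨w, hw⟩
  · exact ⟨c, fun v => c v v, hc, by simp, by simp⟩
  obtain ⟨u₁, hu₁, h2'⟩ : ∃ u₁ ∈ N, ∀ u ∈ N, u ≠ u₁ → 2 ≤ (A u).card := by
    by_cases h : u₀ ∈ N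
    · exact ⟨u₀, h, h2⟩
    · exact ⟨w, hw, fun u hu _ => h2 u hu (by rintro rfl; exact h hu)⟩
  have hsub : ∀ u, ∃ B ⊆ A u, u ∈ N → B.card = if u = u₁ then 1 else 2 := by
    intro u
    by_cases hu : u ∈ N
    · obtain ⟨B, hB, hB'⟩ := Finset.exists_subset_card_eq (s := A u)
        (n := if u = u₁ then 1 else 2) (by
          split_ifs with h
          · exact h1 u hu
          · exact h2' u hu h)
      exact ⟨B, hB, fun _ => hB'⟩
    · exact ⟨∅, by simp, fun h => absurd h hu⟩
  choose B hBA hBcard using hsub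
  -- Lists are cut to size two, and to size one at `u₁`, to make their total size odd. Minimizing
  -- the sum of squares makes the frequencies of any two colors differ by at most two.
  let P : ℕ → Prop := fun m => ∃ (c : V → V → α) (A : V → Finset α), G.IsEdgeColoring K c ∧
    (∀ u ∈ N, ∀ i ∈ A u, i ∈ K ∧ G.MissesColor c u i) ∧
    (∀ u ∈ N, (A u).card = if u = u₁ then 1 else 2) ∧
    ∑ l ∈ K, (N.filter (fun u => l ∈ A u)).card ^ 2 = m
  have hP : ∃ m, P m := ⟨_, c, B, hc, fun u hu i hi => hA u hu i (hBA u hi), hBcard, rfl⟩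
  obtain ⟨c, A, hc, hA, hcard, hm⟩ := Nat.find_spec hP
  have hbal : ∀ i ∈ K, ∀ j ∈ K, (N.filter (fun u => i ∈ A u)).card ≤
      (N.filter (fun u => j ∈ A u)).card + 2 := by
    intro i hi j hj
    by_contra hlt
    obtain ⟨c', A', hc', hA', hcard', hm'⟩ := hc.exists_balance N A hA hi hj (by omega)
    rw [hm] at hm'
    exact Nat.find_min hP hm' ⟨c', A', hc', hA', fun u hu => (hcard' u).trans (hcard u hu), rfl⟩
  have hsum : ∑ l ∈ K, (N.filter (fun u => l ∈ A u)).card + 1 = 2 * N.card := by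
    have e1 : ∑ l ∈ K, (N.filter (fun u => l ∈ A u)).card = ∑ u ∈ N, (A u).card := by
      simp_rw [Finset.card_filter]
      rw [Finset.sum_comm]
      refine Finset.sum_congr rfl fun u hu => ?_
      rw [← Finset.card_filter]
      congr 1
      ext l
      simp only [Finset.mem_filter]
      exact ⟨fun h => h.2, fun h => ⟨(hA u hu l h).1, h⟩⟩
    rw [e1, Finset.sum_congr rfl hcard, ← Finset.add_sum_erase _ _ hu₁, if_pos rfl,
      Finset.sum_congr rfl (g := fun _ => 2)
        (fun u hu => by rw [if_neg (Finset.ne_of_mem_erase hu)]),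
      Finset.sum_const, smul_eq_mul, Finset.card_erase_of_mem hu₁]
    have := Finset.card_pos.2 ⟨_, hu₁⟩
    omega
  -- The frequencies sum to `2|N| - 1 < 2|K|`, so some frequency is below two. If none were one, it
  -- would be zero, and by balance all would be zero or two, contradicting the odd sum.
  obtain ⟨i, hi, hXi⟩ : ∃ i ∈ K, (N.filter (fun u => i ∈ A u)).card = 1 := by
    by_contra! hno
    obtain ⟨i, hi, hi2⟩ : ∃ i ∈ K, (N.filter (fun u => i ∈ A u)).card < 2 := by
      by_contra! hge
      have := Finset.card_nsmul_le_sum K _ 2 hge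
      rw [smul_eq_mul] at this
      omega
    have hi0 : (N.filter (fun u => i ∈ A u)).card = 0 := by
      have := hno i hi
      omega
    have heven : Even (∑ l ∈ K, (N.filter (fun u => l ∈ A u)).card) := by
      refine Finset.even_sum _ fun l hl => ?_
      have h3 := hbal l hl i hi
      have h4 := hno l hl
      have h5 : (N.filter (fun u => l ∈ A u)).card = 0 ∨
          (N.filter (fun u => l ∈ A u)).card = 2 := by omega
      rcases h5 with h5 | h5 <;> rw [h5] <;> decide
    obtain ⟨r, hr⟩ := heven
    omega
  obtain ⟨u, hu⟩ := Finset.card_eq_one.1 hXi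
  have hu' : u ∈ N ∧ i ∈ A u := by
    have : u ∈ N.filter (fun u => i ∈ A u) := by simp [hu]
    simpa using this
  have huniq : ∀ v ∈ N, i ∈ A v → v = u := by
    intro v hv hv'
    have : v ∈ N.filter (fun u => i ∈ A u) := by simp [hv, hv']
    simpa [hu] using this
  -- The color `i` is reserved for `u`, the only vertex listing it. Its edge class is set aside, and
  -- induction treats the rest without `i` and `u`.
  let G' : SimpleGraph V :=
    { Adj := fun a b => G.Adj a b ∧ c a b ≠ i
      symm := ⟨fun a b h => ⟨h.1.symm, hc.symm a b h.1 ▸ h.2⟩⟩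
      loopless := ⟨fun a h => G.irrefl h.1⟩ }
  obtain ⟨c', f, hc', hf, hf'⟩ := ih G' (K.erase i) c
    ⟨fun a b h => Finset.mem_erase.2 ⟨h.2, hc.mem a b h.1⟩, fun a b h => hc.symm a b h.1,
      fun a b b' h h' => hc.inj a b b' h.1 h'.1⟩ (N.erase u) A
    (fun v hv l hl => by
      obtain ⟨hv1, hv2⟩ := Finset.mem_erase.1 hv
      obtain ⟨h3, h4⟩ := hA v hv2 l hl
      refine ⟨Finset.mem_erase.2 ⟨?_, h3⟩, fun b hb => h4 b hb.1⟩
      rintro rfl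
      exact hv1 (huniq v hv2 hl)) u₁
    (fun v hv => by
      rw [hcard v (Finset.mem_of_mem_erase hv)]
      split_ifs <;> omega)
    (fun v hv h => by
      rw [hcard v (Finset.mem_of_mem_erase hv), if_neg h])
    (by
      rw [Finset.card_erase_of_mem hu'.1, Finset.card_erase_of_mem hi]
      omega)
    (by
      rw [Finset.card_erase_of_mem hi]
      omega)
  have hG' : ∀ {a b}, G.Adj a b → c a b ≠ i → G'.Adj a b := fun h h' => ⟨h, h'⟩
  have hne : ∀ {a b}, G'.Adj a b → c' a b ≠ i := fun h => Finset.ne_of_mem_erase (hc'.mem _ _ h)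
  refine ⟨fun a b => if c a b = i then i else c' a b, fun v => if v = u then i else f v,
    ⟨?_, ?_, ?_⟩, ?_, ?_⟩
  · intro a b h
    split_ifs with h3
    · exact hi
    · exact Finset.mem_of_mem_erase (hc'.mem a b (hG' h h3))
  · intro a b h
    rw [← hc.symm a b h]
    split_ifs with h3
    · rfl
    · exact hc'.symm a b (hG' h h3)
  · intro a b b' h h' he
    split_ifs at he with h3 h4 h4
    · exact hc.inj a b b' h h' (h3.trans h4.symm)
    · exact absurd he.symm (hne (hG' h' h4))
    · exact absurd he (hne (hG' h h3))
    · exact hc'.inj a b b' (hG' h h3) (hG' h' h4) he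
  · have hfi : ∀ v ∈ N, v ≠ u → f v ≠ i := fun v hv hvu =>
      Finset.ne_of_mem_erase (hf' v (Finset.mem_erase.2 ⟨hvu, hv⟩)).1
    intro v hv v' hv' he
    simp only [Finset.mem_coe] at hv hv'
    dsimp only at he
    split_ifs at he with h3 h4 h4
    · exact h3.trans h4.symm
    · exact absurd he.symm (hfi v' hv' h4)
    · exact absurd he (hfi v hv h3)
    · exact hf (by simp [h3, hv]) (by simp [h4, hv']) he
  · intro v hv
    dsimp only
    by_cases hvu : v = u
    · subst hvu
      rw [if_pos rfl]
      refine ⟨hi, fun b hb => ?_⟩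
      have h3 := (hA v hv i hu'.2).2 b hb
      dsimp only
      rw [if_neg h3]
      exact hne (hG' hb h3)
    · rw [if_neg hvu]
      obtain ⟨h3, h4⟩ := hf' v (Finset.mem_erase.2 ⟨hvu, hv⟩)
      refine ⟨Finset.mem_of_mem_erase h3, fun b hb => ?_⟩
      dsimp only
      split_ifs with h5
      · exact (Finset.ne_of_mem_erase h3).symm
      · exact h4 b (hG' hb h5)

open Classical in
theorem card_le_card_missesColor_add_degree {V α : Type*} [Fintype V] (G : SimpleGraph V)
    (K : Finset α) (c : V → V → α) (u : V) :
    K.card ≤ (K.filter (fun i => G.MissesColor c u i)).card + G.degree u := by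
  rw [← Finset.card_filter_add_card_filter_not (s := K) (fun i => G.MissesColor c u i)]
  refine Nat.add_le_add_left ?_ _
  rw [← card_neighborFinset_eq_degree]
  refine (Finset.card_le_card (t := (G.neighborFinset u).image (c u)) ?_).trans
    Finset.card_image_le
  intro i hi
  have h := (Finset.mem_filter.1 hi).2
  unfold MissesColor at h
  push Not at h
  obtain ⟨b, hb, hbi⟩ := h
  exact Finset.mem_image.2 ⟨b, by simpa using hb, hbi⟩

open Classical in
/-- **Vizing–Fournier theorem.** If all degrees are at most `k` and the vertices of degree `k`
are pairwise nonadjacent, then `G` has a proper edge coloring with `k` colors. -/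
theorem exists_isEdgeColoring {V : Type*} [Fintype V] (G : SimpleGraph V) (k : ℕ)
    (hk : ∀ v, G.degree v ≤ k)
    (hind : ∀ v w, G.Adj v w → G.degree v = k → G.degree w ≠ k) :
    ∃ c : V → V → ℕ, G.IsEdgeColoring (Finset.range k) c := by
  induction G using WellFoundedLT.induction with
  | ind G ih =>
  by_cases hbot : G = ⊥
  · subst hbot
    exact ⟨fun _ _ => 0, by simp, by simp, by simp⟩
  obtain ⟨a, b, hab⟩ := ne_bot_iff_exists_adj.1 hbot
  -- A vertex of degree `k` qualifies by independence; if there is none, any vertex with an edge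
  -- does. Its neighbors then have degree at most `k - 2` once it is removed, so each misses two
  -- colors.
  obtain ⟨v, w, hvw, hv⟩ : ∃ v w, G.Adj v w ∧ ∀ u, G.Adj v u → G.degree u + 1 ≤ k := by
    by_cases h : ∃ v, G.degree v = k
    · obtain ⟨v, hv⟩ := h
      have h0 : 0 < G.degree a := (G.degree_pos_iff_exists_adj a).2 ⟨b, hab⟩
      have h1 := hk a
      obtain ⟨w, hw⟩ := (G.degree_pos_iff_exists_adj v).1 (by omega)
      exact ⟨v, w, hw, fun u hu => lt_of_le_of_ne (hk u) (hind v u hu hv)⟩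
    · push Not at h
      exact ⟨a, b, hab, fun u _ => lt_of_le_of_ne (hk u) (h u)⟩
  obtain ⟨G', hadj⟩ : ∃ G' : SimpleGraph V, ∀ a b, G'.Adj a b ↔ G.Adj a b ∧ a ≠ v ∧ b ≠ v :=
    ⟨G.deleteIncidenceSet v, fun a b => deleteIncidenceSet_adj⟩
  have hle : G' ≤ G := fun a b h => ((hadj a b).1 h).1
  have hdeg : ∀ u, G'.degree u ≤ G.degree u := fun u => degree_le_of_le hle
  obtain ⟨c, hc⟩ := ih G' (lt_of_le_of_ne hle (by
      intro h
      have := (hadj v w).1 (h ▸ hvw)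
      exact this.2.1 rfl))
    (fun u => (hdeg u).trans (hk u))
    (fun x y hxy hx hy => hind x y (hle hxy) (le_antisymm (hk x) (hx ▸ hdeg x))
      (le_antisymm (hk y) (hy ▸ hdeg y)))
  have hmiss : ∀ u ∈ G.neighborFinset v,
      2 ≤ ((Finset.range k).filter (fun i => G'.MissesColor c u i)).card := by
    intro u hu
    rw [mem_neighborFinset] at hu
    have h1 := card_le_card_missesColor_add_degree G' (Finset.range k) c u
    have h2 : G'.degree u < G.degree u := by
      rw [← card_neighborFinset_eq_degree, ← card_neighborFinset_eq_degree]
      refine Finset.card_lt_card ⟨fun x hx => ?_, fun h => ?_⟩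
      · simp only [mem_neighborFinset] at hx ⊢
        exact hle hx
      · have : v ∈ G'.neighborFinset u := h (by simpa using hu.symm)
        rw [mem_neighborFinset, hadj] at this
        exact this.2.2 rfl
    have h3 := hv u hu
    rw [Finset.card_range] at h1
    omega
  obtain ⟨c', f, hc', hf, hf'⟩ := hc.exists_injOn_missesColor G' (Finset.range k) c
    (G.neighborFinset v) (fun u => (Finset.range k).filter (fun i => G'.MissesColor c u i))
    (fun u _ i hi => Finset.mem_filter.1 hi) v (fun u hu => by
      have := hmiss u hu
      omega) (fun u hu _ => hmiss u hu) (by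
      rw [card_neighborFinset_eq_degree, Finset.card_range]
      exact hk v)
  have hfv : ∀ u, G.Adj v u → f u ∈ Finset.range k ∧ G'.MissesColor c' u (f u) :=
    fun u hu => hf' u (by simpa using hu)
  refine ⟨fun a b => if a = v then f b else if b = v then f a else c' a b, ?_, ?_, ?_⟩
  · intro a b h
    split_ifs with h1 h2
    · exact (hfv b (h1 ▸ h)).1
    · exact (hfv a (h2 ▸ h.symm)).1
    · exact hc'.mem a b ((hadj a b).2 ⟨h, h1, h2⟩)
  · intro a b h
    split_ifs with h1 h2 h2
    · rw [h1, h2]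
    · rfl
    · rfl
    · exact hc'.symm a b ((hadj a b).2 ⟨h, h1, h2⟩)
  · intro a b b' h h' he
    split_ifs at he with h1 h2 h3 h3
    · subst h1
      exact hf (by simpa using h) (by simpa using h') he
    · rw [h2, h3]
    · subst h2
      exact absurd he.symm ((hfv a h.symm).2 b' ((hadj a b').2 ⟨h', h1, h3⟩))
    · subst h3
      exact absurd he ((hfv a h'.symm).2 b ((hadj a b).2 ⟨h, h1, h2⟩))
    · exact hc'.inj a b b' ((hadj a b).2 ⟨h, h1, h2⟩) ((hadj a b').2 ⟨h', h1, h3⟩) he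

/-! ### Total colorings, their lower bound, and addition modulo an odd number -/

/-- A proper edge coloring together with a compatible vertex coloring is a total coloring. -/
theorem IsEdgeColoring.totalColorable {V α : Type*} {G : SimpleGraph V} {K : Finset α}
    {c : V → V → α} (hc : G.IsEdgeColoring K c) (f : V → α) (hfK : ∀ v, f v ∈ K)
    (hf : ∀ v w, G.Adj v w → f v ≠ f w) (hfc : ∀ v w, G.Adj v w → f v ≠ c v w) :
    G.TotalColorable K.card := by
  let φ : K ≃ Fin K.card := K.equivFin
  have hout : ∀ e : G.edgeSet, G.Adj (Quot.out e.1).1 (Quot.out e.1).2 := fun e => by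
    rw [← mem_edgeSet, Sym2.mk, Quot.out_eq]
    exact e.2
  let ec : G.edgeSet → K := fun e => ⟨c (Quot.out e.1).1 (Quot.out e.1).2, hc.mem _ _ (hout e)⟩
  have hec : ∀ (e : G.edgeSet) (v : V), v ∈ (e : Sym2 V) →
      ∃ w, G.Adj v w ∧ e.1 = s(v, w) ∧ (ec e : α) = c v w := by
    intro e v hv
    have he : e.1 = s((Quot.out e.1).1, (Quot.out e.1).2) := by
      rw [Sym2.mk, Quot.out_eq]
    rw [he, Sym2.mem_iff] at hv
    rcases hv with rfl | rfl
    · exact ⟨_, hout e, he, rfl⟩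
    · exact ⟨_, (hout e).symm, he.trans Sym2.eq_swap, hc.symm _ _ (hout e)⟩
  refine ⟨⟨fun v => φ ⟨f v, hfK v⟩, fun e => φ (ec e), ?_, ?_, ?_⟩⟩
  · intro v w h he
    exact hf v w h (congrArg Subtype.val (φ.injective he))
  · rintro e e' hne ⟨v, hv, hv'⟩ he
    obtain ⟨w, hw, h1, h2⟩ := hec e v hv
    obtain ⟨w', hw', h1', h2'⟩ := hec e' v hv'
    have := hc.inj v w w' hw hw' (by rw [← h2, ← h2', φ.injective he])
    exact hne (Subtype.ext (by rw [h1, h1', this]))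
  · intro v e hv he
    obtain ⟨w, hw, h1, h2⟩ := hec e v hv
    exact hfc v w hw ((congrArg Subtype.val (φ.injective he)).trans h2)

theorem TotalColorable.mono {V : Type*} {G : SimpleGraph V} {m n : ℕ} (h : G.TotalColorable m)
    (hmn : m ≤ n) : G.TotalColorable n := by
  obtain ⟨t⟩ := h
  have hi := Fin.castLE_injective hmn
  exact ⟨⟨fun v => Fin.castLE hmn (t.vertexColor v), fun e => Fin.castLE hmn (t.edgeColor e),
    fun v w h => hi.ne (t.vertex_ne v w h), fun e f h h' => hi.ne (t.edge_ne e f h h'),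
    fun v e h => hi.ne (t.vertex_ne_edge v e h)⟩⟩

open Classical in
theorem TotalColorable.degree_lt {V : Type*} [Fintype V] {G : SimpleGraph V} {n : ℕ}
    (h : G.TotalColorable n) (v : V) : G.degree v < n := by
  obtain ⟨t⟩ := h
  -- `none` stands for the vertex itself, whose color differs from those of its edges.
  let g : Option (G.neighborSet v) → Fin n := fun o =>
    o.elim (t.vertexColor v) (fun w => t.edgeColor ⟨s(v, w), w.2⟩)
  have hg : Function.Injective g := by
    intro x y hxy
    cases x with
    | none =>
      cases y with
      | none => rfl
      | some y => exact absurd hxy (t.vertex_ne_edge v _ (by simp))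
    | some x =>
      cases y with
      | none => exact absurd hxy.symm (t.vertex_ne_edge v _ (by simp))
      | some y =>
        by_contra hne
        refine t.edge_ne _ _ ?_ ⟨v, by simp, by simp⟩ hxy
        intro he
        apply hne
        have := congrArg Subtype.val he
        rw [Sym2.congr_right] at this
        rw [Subtype.ext this]
  have := Fintype.card_le_of_injective g hg
  rw [Fintype.card_option, card_neighborSet_eq_degree, Fintype.card_fin] at this
  omega

open Classical in
theorem finiteMaxDegree_eq {V : Type*} [Fintype V] (G : SimpleGraph V) :
    G.finiteMaxDegree = G.maxDegree := by
  unfold finiteMaxDegree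
  congr!

open Classical in
theorem degree_le_finiteMaxDegree {V : Type*} [Fintype V] (G : SimpleGraph V) (v : V) :
    G.degree v ≤ G.finiteMaxDegree := by
  rw [finiteMaxDegree_eq]
  exact G.degree_le_maxDegree v

/-- Only the upper bound has to be proved in the Total Coloring Conjecture. -/
theorem TotalColorable.satisfiesTotalColoringConjecture {V : Type*} [Finite V]
    {G : SimpleGraph V} (h : G.TotalColorable (G.finiteMaxDegree + 2)) :
    G.SatisfiesTotalColoringConjecture := by
  classical
  have := Fintype.ofFinite V
  have hle : G.totalChromaticNumber ≤ (G.finiteMaxDegree : ℕ∞) + 2 := by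
    refine (iInf₂_le (G.finiteMaxDegree + 2) h).trans ?_
    simp
  refine ⟨hle, fun hV => ?_⟩
  have hge : (G.finiteMaxDegree : ℕ∞) + 1 ≤ G.totalChromaticNumber := by
    refine le_iInf₂ fun n hn => ?_
    obtain ⟨v, hv⟩ := G.exists_maximal_degree_vertex
    have := TotalColorable.degree_lt hn v
    rw [finiteMaxDegree_eq]
    rw [← hv] at this
    exact_mod_cast this
  lift G.totalChromaticNumber to ℕ using ne_top_of_le_ne_top (by
    exact_mod_cast ENat.natCast_ne_top (G.finiteMaxDegree + 2)) hle with x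
  norm_cast at hle hge ⊢
  omega

/-- A graph whose closed neighborhoods are colored injectively by `Fin m`, with `m` odd, has a
total coloring with `m` colors. -/
theorem totalColorable_of_odd {V : Type*} {G : SimpleGraph V} {m : ℕ} (hm : Odd m)
    (f : V → ℕ) (hfm : ∀ v, f v < m) (hf : ∀ v w, G.Adj v w → f v ≠ f w)
    (hf' : ∀ v w w', G.Adj v w → G.Adj v w' → f w = f w' → w = w') : G.TotalColorable m := by
  have hcancel : ∀ a b c, b < m → c < m → (a + b) % m = (a + c) % m → b = c := by
    intro a b c hb hc h
    have : b ≡ c [MOD m] := Nat.ModEq.add_left_cancel' a h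
    exact Nat.ModEq.eq_of_lt_of_lt this hb hc
  have hc : G.IsEdgeColoring (Finset.range m) (fun a b => (f a + f b) % m) :=
    ⟨fun a b _ => Finset.mem_range.2 (Nat.mod_lt _ hm.pos), fun a b _ => by rw [add_comm],
      fun a b b' h h' he => hf' a b b' h h' (hcancel _ _ _ (hfm _) (hfm _) he)⟩
  have := hc.totalColorable (fun v => (f v + f v) % m)
    (fun v => Finset.mem_range.2 (Nat.mod_lt _ hm.pos))
    (fun v w h he => by
      -- A vertex gets twice its label; as `m` is odd, doubling is injective modulo `m`.
      have h2 : 2 * f v ≡ 2 * f w [MOD m] := by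
        rw [two_mul, two_mul]
        exact he
      refine hf v w h (Nat.ModEq.eq_of_lt_of_lt (Nat.ModEq.cancel_left_of_coprime ?_ h2)
        (hfm v) (hfm w))
      rw [← Nat.Coprime]
      exact hm.coprime_two_right)
    (fun v w h he => hf v w h (hcancel _ _ _ (hfm _) (hfm _) he))
  rwa [Finset.card_range] at this

/-! ### The cone construction and independent sets -/

open Classical in
/-- Let the vertices in `W` and the edges of `R` already have compatible colors from `K`. The
other vertices get pairwise distinct new colors and the other edges get new colors from an edge
coloring of the cone over the vertices outside `W`. -/
theorem totalColorable_of_cone {V α : Type*} [Fintype V] {G R D : SimpleGraph V}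
    (hG : ∀ a b, G.Adj a b → R.Adj a b ∨ D.Adj a b) {K : Finset α} {r : V → V → α}
    (hr : R.IsEdgeColoring K r) (W : Finset V) (g : V → α) (hgK : ∀ v ∈ W, g v ∈ K)
    (hg : ∀ v ∈ W, ∀ w ∈ W, G.Adj v w → g v ≠ g w)
    (hgr : ∀ v ∈ W, ∀ w, R.Adj v w → g v ≠ r v w) (k : ℕ) (hW : Wᶜ.card < k)
    (hk : ∀ v, D.degree v + (if v ∈ W then 0 else 1) ≤ k)
    (hind : ∀ v w, D.Adj v w → D.degree v + (if v ∈ W then 0 else 1) = k →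
      D.degree w + (if w ∈ W then 0 else 1) ≠ k) :
    G.TotalColorable (K.card + k) := by
  -- In the cone, `none` is the apex. Its degree is below `k`, so it never meets the independence
  -- condition of the Vizing–Fournier theorem.
  obtain ⟨H, hHs, hH0, hHn⟩ : ∃ H : SimpleGraph (Option V),
      (∀ a b, H.Adj (some a) (some b) ↔ D.Adj a b) ∧ (∀ a, H.Adj none (some a) ↔ a ∉ W) ∧
      ∀ a, H.Adj (some a) none ↔ a ∉ W := by
    refine ⟨SimpleGraph.mk (fun x y => match x, y with
      | none, none => False
      | none, some a => a ∉ W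
      | some a, none => a ∉ W
      | some a, some b => D.Adj a b) ⟨?_⟩ ⟨?_⟩, fun _ _ => Iff.rfl, fun _ => Iff.rfl,
        fun _ => Iff.rfl⟩
    · rintro (_ | a) (_ | b) h
      · exact h
      · exact h
      · exact h
      · exact D.adj_symm h
    · rintro (_ | a) h
      · exact h
      · exact D.irrefl h
  have hdeg : ∀ v, H.degree (some v) ≤ D.degree v + (if v ∈ W then 0 else 1) := by
    intro v
    rw [← card_neighborFinset_eq_degree, ← card_neighborFinset_eq_degree]
    refine (Finset.card_le_card (t := (D.neighborFinset v).map Function.Embedding.some ∪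
      (if v ∈ W then ∅ else {none})) ?_).trans ((Finset.card_union_le _ _).trans ?_)
    · rintro (_ | b) hb
      · rw [mem_neighborFinset, hHn] at hb
        simp [hb]
      · rw [mem_neighborFinset, hHs] at hb
        simp [hb]
    · rw [Finset.card_map]
      split_ifs <;> simp
  have hnone : H.degree none < k := by
    rw [← card_neighborFinset_eq_degree]
    refine (Finset.card_le_card (t := Wᶜ.map Function.Embedding.some) ?_).trans_lt
      (by rwa [Finset.card_map])
    rintro (_ | b) hb
    · simp at hb
    · rw [mem_neighborFinset, hH0] at hb
      simp [hb]
  obtain ⟨d, hd⟩ := exists_isEdgeColoring H k (by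
      rintro (_ | v)
      · exact hnone.le
      · exact (hdeg v).trans (hk v)) (by
      rintro (_ | v) (_ | w) hvw h1 h2
      · omega
      · omega
      · omega
      · exact hind v w ((hHs v w).1 hvw) (le_antisymm (hk v) (h1 ▸ hdeg v))
          (le_antisymm (hk w) (h2 ▸ hdeg w)))
  have hD : ∀ {a b}, G.Adj a b → ¬ R.Adj a b → H.Adj (some a) (some b) := fun h h' =>
    (hHs _ _).2 ((hG _ _ h).resolve_left h')
  have hc : G.IsEdgeColoring (K.disjSum (Finset.range k))
      (fun a b => if R.Adj a b then Sum.inl (r a b) else Sum.inr (d (some a) (some b))) := by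
    refine ⟨fun a b h => ?_, fun a b h => ?_, fun a b b' h h' he => ?_⟩
    · split_ifs with h1
      · exact Finset.inl_mem_disjSum.2 (hr.mem a b h1)
      · exact Finset.inr_mem_disjSum.2 (hd.mem _ _ (hD h h1))
    · rw [R.adj_comm b a]
      split_ifs with h1
      · rw [hr.symm a b h1]
      · rw [hd.symm _ _ (hD h h1)]
    · split_ifs at he with h1 h2 h2
      · exact hr.inj a b b' h1 h2 (Sum.inl_injective he)
      · exact Option.some_injective _ (hd.inj _ _ _ (hD h h1) (hD h' h2) (Sum.inr_injective he))
  have := hc.totalColorable (fun v => if v ∈ W then Sum.inl (g v) else Sum.inr (d none (some v)))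
    (fun v => by
      split_ifs with h1
      · exact Finset.inl_mem_disjSum.2 (hgK v h1)
      · exact Finset.inr_mem_disjSum.2 (hd.mem _ _ ((hH0 v).2 h1)))
    (fun v w h he => by
      split_ifs at he with h1 h2 h2
      · exact hg v h1 w h2 h (Sum.inl_injective he)
      · have := hd.inj _ _ _ ((hH0 v).2 h1) ((hH0 w).2 h2) (Sum.inr_injective he)
        exact h.ne (Option.some_injective _ this))
    (fun v w h he => by
      split_ifs at he with h1 h2 h2
      · exact hgr v h1 w h2 (Sum.inl_injective he)
      · have h3 := Sum.inr_injective he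
        rw [hd.symm _ _ ((hH0 v).2 h1)] at h3
        have := hd.inj _ _ _ ((hHn v).2 h1) (hD h h2) h3
        simp at this)
  rwa [Finset.card_disjSum, Finset.card_range] at this

/-- Every finite graph has a maximal matching. -/
theorem exists_maximal_matching {V : Type*} [Finite V] (D : SimpleGraph V) :
    ∃ M ≤ D, (∀ a b b', M.Adj a b → M.Adj a b' → b = b') ∧
      ∀ a b, D.Adj a b → (∃ x, M.Adj a x) ∨ ∃ x, M.Adj b x := by
  obtain ⟨M, hM⟩ := (Set.toFinite {M : SimpleGraph V | M ≤ D ∧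
    ∀ a b b', M.Adj a b → M.Adj a b' → b = b'}).exists_maximal ⟨⊥, by simp⟩
  refine ⟨M, hM.1.1, hM.1.2, fun a b hab => ?_⟩
  by_contra! h
  have hle := hM.2 (y := M ⊔ edge a b) ⟨?_, ?_⟩ le_sup_left
  · exact h.1 b (hle (Or.inr (by simp [edge_adj, hab.ne])))
  · refine sup_le hM.1.1 fun x y hxy => ?_
    rw [edge_adj] at hxy
    rcases hxy.1 with ⟨rfl, rfl⟩ | ⟨rfl, rfl⟩
    · exact hab
    · exact hab.symm
  · intro x y y' hy hy'
    have := hM.1.2 x y y'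
    have h1 := h.1
    have h2 := h.2
    simp only [sup_adj, edge_adj] at hy hy'
    grind

open Classical in
/-- If the complement of an independent set `S` has at most `D` elements, where `D` bounds the
degrees, then `G` has a total coloring with `D + 2` colors. -/
theorem totalColorable_of_independent {V : Type*} [Fintype V] (G : SimpleGraph V) (S : Finset V)
    (hS : ∀ v ∈ S, ∀ w ∈ S, ¬ G.Adj v w) (D : ℕ) (hD : ∀ v, G.degree v ≤ D) (hSD : Sᶜ.card ≤ D) :
    G.TotalColorable (D + 2) := by
  -- The matching shares the color of `S`, so it must avoid `S`. Only vertices outside `S` of degree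
  -- `D` can reach degree `D + 1` in the cone; those left unmatched are pairwise nonadjacent by
  -- maximality.
  obtain ⟨E, hE⟩ : ∃ E : SimpleGraph V, ∀ a b, E.Adj a b ↔
      G.Adj a b ∧ (a ∉ S ∧ G.degree a = D) ∧ (b ∉ S ∧ G.degree b = D) :=
    ⟨⟨fun a b => G.Adj a b ∧ (a ∉ S ∧ G.degree a = D) ∧ (b ∉ S ∧ G.degree b = D),
      ⟨fun _ _ h => ⟨h.1.symm, h.2.2, h.2.1⟩⟩, ⟨fun _ h => G.irrefl h.1⟩⟩, fun _ _ => Iff.rfl⟩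
  obtain ⟨M, hME, hM, hmax⟩ := exists_maximal_matching E
  obtain ⟨F, hF⟩ : ∃ F : SimpleGraph V, ∀ a b, F.Adj a b ↔ G.Adj a b ∧ ¬ M.Adj a b :=
    ⟨G \ M, fun a b => Iff.rfl⟩
  have hFG : ∀ v, F.degree v ≤ G.degree v := fun v => degree_le_of_le fun a b h => ((hF a b).1 h).1
  have hcov : ∀ v x, M.Adj v x → F.degree v < G.degree v := by
    intro v x hx
    rw [← card_neighborFinset_eq_degree, ← card_neighborFinset_eq_degree]
    refine Finset.card_lt_card ⟨fun y hy => ?_, fun h => ?_⟩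
    · rw [mem_neighborFinset] at hy ⊢
      exact ((hF v y).1 hy).1
    · have : x ∈ F.neighborFinset v := h (by simpa using ((hE v x).1 (hME hx)).1)
      rw [mem_neighborFinset, hF] at this
      exact this.2 hx
  have hr : M.IsEdgeColoring {()} (fun _ _ => ()) :=
    ⟨by simp, by simp, fun a b b' h h' _ => hM a b b' h h'⟩
  have hfull : ∀ v, F.degree v + (if v ∈ S then 0 else 1) = D + 1 →
      v ∉ S ∧ G.degree v = D ∧ ∀ x, ¬ M.Adj v x := by
    intro v h
    have h1 := hFG v
    have h2 := hD v
    split_ifs at h with h3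
    · omega
    · refine ⟨h3, by omega, fun x hx => ?_⟩
      have := hcov v x hx
      omega
  have := totalColorable_of_cone (G := G) (R := M) (D := F)
    (fun a b h => by
      rw [hF]
      tauto) hr S (fun _ => ()) (by simp) (fun v hv w hw h => absurd h (hS v hv w hw))
    (fun v hv w h => absurd hv ((hE v w).1 (hME h)).2.1.1) (D + 1) (by omega)
    (fun v => by
      have h1 := hFG v
      have h2 := hD v
      split_ifs <;> omega)
    (fun v w hvw h1 h2 => by
      obtain ⟨a1, a2, a3⟩ := hfull v h1
      obtain ⟨b1, b2, b3⟩ := hfull w h2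
      rcases hmax v w ((hE v w).2 ⟨((hF v w).1 hvw).1, ⟨a1, a2⟩, b1, b2⟩) with ⟨x, hx⟩ | ⟨x, hx⟩
      · exact a3 x hx
      · exact b3 x hx)
  exact this.mono (by
    rw [Finset.card_singleton]
    omega)

/-! ### Matchings covering a clique, and the resulting total coloring -/

open Classical in
theorem IsEdgeColoring.degree_le_card {V α : Type*} [Fintype V] {G : SimpleGraph V}
    {K : Finset α} {c : V → V → α} (hc : G.IsEdgeColoring K c) (v : V) :
    G.degree v ≤ K.card := by
  rw [← card_neighborFinset_eq_degree]
  refine Finset.card_le_card_of_injOn (c v) (fun w hw => ?_) fun w hw w' hw' h => ?_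
  · exact hc.mem v w (by simpa using hw)
  · exact hc.inj v w w' (by simpa using hw) (by simpa using hw') h

open Classical in
/-- A matching that covers a clique `Q` in which every vertex has many neighbors outside `Q`,
that avoids the two vertices in `F` and the edges of a graph `R` of small degree. -/
theorem exists_matching_covering {V : Type*} [Fintype V] {G R : SimpleGraph V} {Q F : Finset V}
    {p t : ℕ} (hp : 2 ≤ p) (ht : t < p) (hQ : ∀ u ∈ Q, ∀ v ∈ Q, u ≠ v → G.Adj u v)
    (hF : F.card ≤ 2) (hQF : Disjoint Q F) (hR : ∀ u ∈ Q, R.degree u ≤ t)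
    (hout : ∀ u ∈ Q, 2 * p ≤ (G.neighborFinset u \ Q).card) :
    ∃ M ≤ G, (∀ a b, M.Adj a b → ¬ R.Adj a b) ∧ (∀ a b b', M.Adj a b → M.Adj a b' → b = b') ∧
      (∀ u ∈ Q, ∃ w, M.Adj u w) ∧ ∀ a b, M.Adj a b → a ∉ F := by
  obtain ⟨E, hE⟩ : ∃ E : SimpleGraph V, ∀ a b, E.Adj a b ↔
      G.Adj a b ∧ ¬ R.Adj a b ∧ a ∈ Q ∧ b ∈ Q :=
    ⟨⟨fun a b => G.Adj a b ∧ ¬ R.Adj a b ∧ a ∈ Q ∧ b ∈ Q,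
      ⟨fun _ _ h => ⟨h.1.symm, fun h' => h.2.1 h'.symm, h.2.2.2, h.2.2.1⟩⟩,
      ⟨fun _ h => G.irrefl h.1⟩⟩, fun _ _ => Iff.rfl⟩
  obtain ⟨M, hME, hM, hmax⟩ := exists_maximal_matching E
  -- By maximality the vertices of `Q` left unmatched form a clique in `R`. Hall's theorem matches
  -- them to vertices outside `Q`.
  set I : Finset V := Q.filter (fun u => ∀ x, ¬ M.Adj u x) with hI
  have hIR : ∀ u ∈ I, ∀ v ∈ I, u ≠ v → R.Adj u v := by
    intro u hu v hv huv
    rw [hI, Finset.mem_filter] at hu hv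
    by_contra h
    rcases hmax u v ((hE u v).2 ⟨hQ u hu.1 v hv.1 huv, h, hu.1, hv.1⟩) with ⟨x, hx⟩ | ⟨x, hx⟩
    · exact hu.2 x hx
    · exact hv.2 x hx
  let T : V → Finset V := fun u => (G.neighborFinset u \ Q) \ (F ∪ (R.neighborFinset u \ Q))
  have hT : ∀ u ∈ I, I.card ≤ (T u).card := by
    intro u hu
    have huQ : u ∈ Q := (Finset.mem_filter.1 hu).1
    have h1 : (G.neighborFinset u \ Q).card ≤
        (T u).card + (F.card + (R.neighborFinset u \ Q).card) := by
      refine le_trans ?_ (Nat.add_le_add_left (Finset.card_union_le _ _) _)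
      exact Finset.card_le_card_sdiff_add_card
    -- The `|I| - 1` neighbors of `u` in the `R`-clique use up part of its `R`-degree. At least `2p
    -- - 2 - (t - |I| + 1)` admissible partners remain outside `Q`, which is at least `|I|` because
    -- `t < p` and `p ≥ 2`.
    have h2 : (I.erase u).card + (R.neighborFinset u \ Q).card ≤ t := by
      refine le_trans ?_ (hR u huQ)
      rw [← card_neighborFinset_eq_degree, ← Finset.card_union_of_disjoint]
      · refine Finset.card_le_card (Finset.union_subset (fun x hx => ?_) Finset.sdiff_subset)
        rw [mem_neighborFinset]
        exact hIR u hu x (Finset.mem_of_mem_erase hx) (Finset.ne_of_mem_erase hx).symm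
      · rw [Finset.disjoint_left]
        intro x hx hx'
        exact (Finset.mem_sdiff.1 hx').2
          (Finset.mem_filter.1 (Finset.mem_of_mem_erase hx)).1
    rw [Finset.card_erase_of_mem hu] at h2
    have h3 := hout u huQ
    have h4 := Finset.card_pos.2 ⟨u, hu⟩
    omega
  obtain ⟨f₀, hf₀, hf₀T⟩ := (Finset.all_card_le_biUnion_card_iff_exists_injective
    (fun u : I => T u)).1 (by
      intro s
      rcases s.eq_empty_or_nonempty with rfl | ⟨u, hu⟩
      · simp
      · calc s.card ≤ I.card := by simpa using Finset.card_le_univ s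
          _ ≤ (T u).card := hT u u.2
          _ ≤ _ := Finset.card_le_card (Finset.subset_biUnion_of_mem (fun u : I => T u) hu))
  obtain ⟨f, hf, hfT⟩ : ∃ f : V → V, (∀ u ∈ I, ∀ v ∈ I, f u = f v → u = v) ∧
      ∀ u ∈ I, G.Adj u (f u) ∧ ¬ R.Adj u (f u) ∧ f u ∉ Q ∧ f u ∉ F := by
    refine ⟨fun u => if h : u ∈ I then f₀ ⟨u, h⟩ else u, fun u hu v hv h => ?_, fun u hu => ?_⟩
    · simp only [hu, hv, dif_pos] at h
      exact congrArg Subtype.val (hf₀ h)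
    · have := hf₀T ⟨u, hu⟩
      simp only [T, Finset.mem_sdiff, Finset.mem_union, mem_neighborFinset] at this
      simp only [hu, dif_pos]
      tauto
  have hIQ : ∀ u ∈ I, u ∈ Q ∧ ∀ x, ¬ M.Adj u x := fun u hu => Finset.mem_filter.1 hu
  have hMQ : ∀ a b, M.Adj a b → G.Adj a b ∧ ¬ R.Adj a b ∧ a ∈ Q ∧ b ∈ Q :=
    fun a b h => (hE a b).1 (hME h)
  have hQF' : ∀ u ∈ Q, u ∉ F := fun u hu => Finset.disjoint_left.1 hQF hu
  refine ⟨⟨fun a b => M.Adj a b ∨ (a ∈ I ∧ f a = b) ∨ (b ∈ I ∧ f b = a), ⟨?_⟩, ⟨?_⟩⟩,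
    ?_, ?_, ?_, ?_, ?_⟩
  · rintro a b (h | h | h)
    · exact Or.inl h.symm
    · exact Or.inr (Or.inr h)
    · exact Or.inr (Or.inl h)
  · rintro a (h | ⟨h, h'⟩ | ⟨h, h'⟩)
    · exact M.irrefl h
    · exact (hfT a h).1.ne h'.symm
    · exact (hfT a h).1.ne h'.symm
  · rintro a b (h | ⟨h, rfl⟩ | ⟨h, rfl⟩)
    · exact (hMQ a b h).1
    · exact (hfT a h).1
    · exact (hfT b h).1.symm
  · rintro a b (h | ⟨h, rfl⟩ | ⟨h, rfl⟩)
    · exact (hMQ a b h).2.1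
    · exact (hfT a h).2.1
    · exact fun h' => (hfT b h).2.1 h'.symm
  · rintro a b b' (h | ⟨h, rfl⟩ | ⟨h, rfl⟩) (h' | ⟨h', rfl⟩ | ⟨h', h''⟩)
    · exact hM a b b' h h'
    · exact absurd h ((hIQ a h').2 b)
    · exact absurd (hMQ a b h).2.2.1 (h'' ▸ (hfT b' h').2.2.1)
    · exact absurd h' ((hIQ a h).2 b')
    · rfl
    · exact absurd (hIQ a h).1 (h'' ▸ (hfT b' h').2.2.1)
    · exact absurd (hMQ _ _ h').2.2.1 (hfT b h).2.2.1
    · exact absurd (hIQ _ h').1 (hfT b h).2.2.1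
    · exact hf b h b' h' h''.symm
  · intro u hu
    by_cases h : ∃ x, M.Adj u x
    · obtain ⟨x, hx⟩ := h
      exact ⟨x, Or.inl hx⟩
    · push Not at h
      exact ⟨f u, Or.inr (Or.inl ⟨Finset.mem_filter.2 ⟨hu, h⟩, rfl⟩)⟩
  · rintro a b (h | ⟨h, rfl⟩ | ⟨h, rfl⟩)
    · exact hQF' a (hMQ a b h).2.2.1
    · exact hQF' a (hIQ a h).1
    · exact (hfT b h).2.2.2

open Classical in
/-- Iterating `exists_matching_covering`: `t` edge-disjoint matchings covering `Q`. -/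
theorem exists_isEdgeColoring_covering {V : Type*} [Fintype V] {G : SimpleGraph V} {Q : Finset V}
    {F : ℕ → Finset V} {p : ℕ} (hp : 2 ≤ p) (hQ : ∀ u ∈ Q, ∀ v ∈ Q, u ≠ v → G.Adj u v)
    (hF : ∀ t < p, (F t).card ≤ 2) (hQF : ∀ t < p, Disjoint Q (F t))
    (hout : ∀ u ∈ Q, 2 * p ≤ (G.neighborFinset u \ Q).card) (t : ℕ) (ht : t ≤ p) :
    ∃ (R : SimpleGraph V) (r : V → V → ℕ), R ≤ G ∧ R.IsEdgeColoring (Finset.range t) r ∧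
      (∀ u ∈ Q, t ≤ R.degree u) ∧ ∀ a b, R.Adj a b → a ∉ F (r a b) := by
  induction t with
  | zero => exact ⟨⊥, fun _ _ => 0, bot_le, ⟨by simp, by simp, by simp⟩, by simp, by simp⟩
  | succ t ih =>
  obtain ⟨R, r, hRG, hr, hcov, hav⟩ := ih (by omega)
  obtain ⟨M, hMG, hMR, hM, hMQ, hMF⟩ := exists_matching_covering (R := R) hp ht hQ (hF t ht)
    (hQF t ht) (fun u _ => by simpa using hr.degree_le_card u) hout
  obtain ⟨R', hR'⟩ : ∃ R' : SimpleGraph V, ∀ a b, R'.Adj a b ↔ R.Adj a b ∨ M.Adj a b :=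
    ⟨R ⊔ M, fun _ _ => Iff.rfl⟩
  have hlt : ∀ a b, R.Adj a b → r a b < t := fun a b h => Finset.mem_range.1 (hr.mem a b h)
  refine ⟨R', fun a b => if R.Adj a b then r a b else t, ?_, ⟨?_, ?_, ?_⟩, ?_, ?_⟩
  · intro a b h
    exact ((hR' a b).1 h).elim (fun h => hRG h) (fun h => hMG h)
  · intro a b h
    rw [Finset.mem_range]
    split_ifs with h1
    · have := hlt a b h1
      omega
    · omega
  · intro a b h
    rw [R.adj_comm b a]
    split_ifs with h1
    · exact hr.symm a b h1
    · rfl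
  · intro a b b' h h' he
    rw [hR'] at h h'
    split_ifs at he with h1 h2 h2
    · exact hr.inj a b b' h1 h2 he
    · have := hlt a b h1
      omega
    · have := hlt a b' h2
      omega
    · exact hM a b b' (h.resolve_left h1) (h'.resolve_left h2)
  · intro u hu
    obtain ⟨w, hw⟩ := hMQ u hu
    refine Nat.lt_of_le_of_lt (hcov u hu) ?_
    rw [← card_neighborFinset_eq_degree, ← card_neighborFinset_eq_degree]
    refine Finset.card_lt_card ⟨fun y hy => ?_, fun h => ?_⟩
    · rw [mem_neighborFinset] at hy ⊢
      exact (hR' u y).2 (Or.inl hy)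
    · have : w ∈ R.neighborFinset u := h (by
        rw [mem_neighborFinset]
        exact (hR' u w).2 (Or.inr hw))
      rw [mem_neighborFinset] at this
      exact hMR u w hw this
  · intro a b h
    dsimp only
    split_ifs with h1
    · exact hav a b h1
    · exact hMF a b (((hR' a b).1 h).resolve_left h1)

open Classical in
/-- Total coloring of a graph in which `p` disjoint pairs of nonadjacent vertices are given and
the vertices of large degree form a clique with many neighbors outside. -/
theorem totalColorable_of_clique {V : Type*} [Fintype V] {G : SimpleGraph V} {Q : Finset V}
    {F : ℕ → Finset V} {p k : ℕ} (hp : 2 ≤ p) (hQ : ∀ u ∈ Q, ∀ v ∈ Q, u ≠ v → G.Adj u v)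
    (hF : ∀ t < p, (F t).card = 2) (hQF : ∀ t < p, Disjoint Q (F t))
    (hFF : ∀ s < p, ∀ t < p, s ≠ t → Disjoint (F s) (F t))
    (hFG : ∀ t < p, ∀ v ∈ F t, ∀ w ∈ F t, ¬ G.Adj v w)
    (hout : ∀ u ∈ Q, 2 * p ≤ (G.neighborFinset u \ Q).card)
    (hdegQ : ∀ v ∈ Q, G.degree v + p < Fintype.card V)
    (hdeg : ∀ v ∉ Q, G.degree v + 2 * p < Fintype.card V)
    (hk : k + p = Fintype.card V + 1) : G.TotalColorable k := by
  obtain ⟨R, r, hRG, hr, hcov, hav⟩ := exists_isEdgeColoring_covering hp hQ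
    (fun t ht => (hF t ht).le) hQF hout p le_rfl
  obtain ⟨D, hD⟩ : ∃ D : SimpleGraph V, ∀ a b, D.Adj a b ↔ G.Adj a b ∧ ¬ R.Adj a b :=
    ⟨G \ R, fun a b => Iff.rfl⟩
  have hDR : ∀ v, D.degree v + R.degree v ≤ G.degree v := by
    intro v
    simp only [← card_neighborFinset_eq_degree]
    rw [← Finset.card_union_of_disjoint]
    · refine Finset.card_le_card (Finset.union_subset (fun x hx => ?_) fun x hx => ?_)
      · rw [mem_neighborFinset] at hx ⊢
        exact ((hD v x).1 hx).1
      · rw [mem_neighborFinset] at hx ⊢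
        exact hRG hx
    · rw [Finset.disjoint_left]
      intro x hx hx'
      rw [mem_neighborFinset] at hx hx'
      exact ((hD v x).1 hx).2 hx'
  set W : Finset V := (Finset.range p).biUnion F with hW
  have hWcard : W.card = 2 * p := by
    rw [hW, Finset.card_biUnion (fun s hs t ht h =>
        hFF s (by simpa using hs) t (by simpa using ht) h),
      Finset.sum_congr rfl (fun t ht => hF t (by simpa using ht))]
    simp [mul_comm]
  have hWV : W.card ≤ Fintype.card V := Finset.card_le_univ W
  have hg : ∀ v, ∃ t, v ∈ W → t < p ∧ v ∈ F t := by
    intro v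
    by_cases h : v ∈ W
    · obtain ⟨t, ht, ht'⟩ := Finset.mem_biUnion.1 h
      exact ⟨t, fun _ => ⟨Finset.mem_range.1 ht, ht'⟩⟩
    · exact ⟨0, fun h' => absurd h' h⟩
  choose g hg using hg
  -- Removing `R` costs each vertex of `Q` at least `p` edges, so the same bound now holds inside
  -- and outside `Q`. It is strict, which makes the independence condition vacuous.
  have hlt : ∀ v, D.degree v + (if v ∈ W then 0 else 1) < k - p := by
    intro v
    have h1 := hDR v
    by_cases hv : v ∈ Q
    · have h2 := hdegQ v hv
      have h3 := hcov v hv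
      split_ifs <;> omega
    · have h2 := hdeg v hv
      split_ifs <;> omega
  have := totalColorable_of_cone (G := G) (R := R) (D := D)
    (fun a b h => by
      rw [hD]
      tauto) hr W g (fun v hv => Finset.mem_range.2 (hg v hv).1)
    (fun v hv w hw h he => hFG _ (hg v hv).1 v (hg v hv).2 w (he ▸ (hg w hw).2) h)
    (fun v hv w h he => hav v w h (he ▸ (hg v hv).2)) (k - p)
    (by
      rw [Finset.card_compl]
      omega)
    (fun v => (hlt v).le) (fun v w _ h => absurd h (hlt v).ne)
  rw [Finset.card_range] at this
  exact this.mono (by omega)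

/-! ### Intersection graphs of set families -/

theorem _root_.Finset.exists_nat_enumeration {V : Type*} [Nonempty V] {B : Finset V} {n : ℕ}
    (h : n ≤ B.card) :
    ∃ f : ℕ → V, (∀ t < n, f t ∈ B) ∧ ∀ s < n, ∀ t < n, f s = f t → s = t := by
  refine ⟨fun t => if ht : t < B.card then B.equivFin.symm ⟨t, ht⟩ else Classical.arbitrary V,
    fun t ht => ?_, fun s hs t ht he => ?_⟩
  · simp [ht.trans_le h]
  · simp only [hs.trans_le h, ht.trans_le h, dif_pos] at he
    simpa using B.equivFin.symm.injective (Subtype.ext he)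

theorem _root_.Finset.exists_nat_labeling {V : Type*} (B : Finset V) :
    ∃ f : V → ℕ, (∀ v ∈ B, f v < B.card) ∧ ∀ v ∈ B, ∀ w ∈ B, f v = f w → v = w := by
  classical
  refine ⟨fun v => if hv : v ∈ B then B.equivFin ⟨v, hv⟩ else 0, fun v hv => ?_,
    fun v hv w hw he => ?_⟩
  · simp [hv]
  · simp only [hv, hw, dif_pos] at he
    exact congrArg Subtype.val (B.equivFin.injective (Fin.ext he))

open Classical in
theorem degree_add_card_lt {V : Type*} [Fintype V] (H : SimpleGraph V) (v : V) (X : Finset V)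
    (hX : ∀ x ∈ X, x ≠ v ∧ ¬ H.Adj v x) : H.degree v + X.card < Fintype.card V := by
  have h1 : v ∉ H.neighborFinset v ∪ X := by
    rw [Finset.mem_union, mem_neighborFinset]
    rintro (h | h)
    · exact H.irrefl h
    · exact (hX v h).1 rfl
  rw [← card_neighborFinset_eq_degree, ← Finset.card_union_of_disjoint]
  · exact Finset.card_lt_univ_of_notMem h1
  · rw [Finset.disjoint_left]
    intro x hx hx'
    exact (hX x hx').2 (by simpa using hx)

open Classical in
/-- The intersection graph of a family of proper nonempty sets that contains all singletons and
all their complements has a total coloring with `D + 2` colors, `D` a bound for the degrees. -/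
theorem totalColorable_of_intersection {V ι : Type*} [Fintype V] [Fintype ι] {H : SimpleGraph V}
    (S : V → Set ι) (hH : ∀ v w, H.Adj v w ↔ v ≠ w ∧ (S v ∩ S w).Nonempty)
    (h0 : ∀ v, S v ≠ ∅) (h1 : ∀ v, S v ≠ Set.univ) (hs : ∀ i, ∃ v, S v = {i})
    (hc : ∀ i, ∃ v, S v = {i}ᶜ) (D : ℕ) (hD : ∀ v, H.degree v ≤ D) :
    H.TotalColorable (D + 2) := by
  rcases isEmpty_or_nonempty V with hV | hV
  · exact totalColorable_of_independent H Finset.univ (fun v => hV.elim v) D hD (by simp)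
  have hι : Nonempty ι := by
    obtain ⟨i, -⟩ := Set.nonempty_iff_ne_empty.2 (h0 hV.some)
    exact ⟨i⟩
  let B : ι → Finset V := fun i => Finset.univ.filter (fun v => S v = {i})
  have hB : ∀ i v, v ∈ B i ↔ S v = {i} := fun i v => by simp [B]
  obtain ⟨i, -, hmin⟩ := Finset.exists_min_image Finset.univ (fun i => (B i).card)
    Finset.univ_nonempty
  have hBdisj : ∀ k l, k ≠ l → Disjoint (B k) (B l) := by
    intro k l hkl
    rw [Finset.disjoint_left]
    intro v hv hv'
    rw [hB] at hv hv'
    exact hkl (Set.singleton_injective (hv.symm.trans hv'))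
  have hBpos : ∀ k, 0 < (B k).card := by
    intro k
    obtain ⟨v, hv⟩ := hs k
    exact Finset.card_pos.2 ⟨v, (hB k v).2 hv⟩
  obtain ⟨m, hm⟩ := hc i
  obtain ⟨j, hj⟩ := Set.nonempty_iff_ne_empty.2 (h0 m)
  have hji : j ≠ i := by simpa [hm] using hj
  by_cases hthree : ∃ l, l ≠ i ∧ l ≠ j
  · obtain ⟨l, hli, hlj⟩ := hthree
    have hother : ∀ k k' : ι, ∃ x, x ≠ k ∧ x ≠ k' := by
      intro k k'
      by_contra! h
      have hi := h i
      have hj := h j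
      have hl := h l
      by_cases hik : i = k <;> by_cases hjk : j = k
      · exact hji (hjk.trans hik.symm)
      · exact hlj ((hl fun hlk => hli (hlk.trans hik.symm)).trans (hj hjk).symm)
      · exact hli ((hl fun hlk => hlj (hlk.trans hjk.symm)).trans (hi hik).symm)
      · exact hji ((hj hjk).trans (hi hik).symm)
    set p := (B i).card with hp
    -- The vertex `m`, whose set is the complement of `{i}`, is adjacent to every other vertex
    -- outside `B i`.
    have hmD : Fintype.card V ≤ D + 1 + p := by
      have hcov : (Finset.univ : Finset V) ⊆ insert m (H.neighborFinset m) ∪ B i := by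
        intro x _
        by_contra hx
        simp only [Finset.mem_union, Finset.mem_insert, mem_neighborFinset, not_or, hB, hH] at hx
        obtain ⟨⟨hxm, hadj⟩, hxi⟩ := hx
        obtain ⟨y, hy⟩ := Set.nonempty_iff_ne_empty.2 (h0 x)
        refine hxi (Set.eq_singleton_iff_nonempty_unique_mem.2 ⟨⟨y, hy⟩, fun z hz => ?_⟩)
        by_contra hzi
        exact hadj ⟨fun h => hxm h.symm, z, by rw [hm]; simpa using hzi, hz⟩
      have h2 := (Finset.card_le_card hcov).trans (Finset.card_union_le _ _)
      have h3 := Finset.card_insert_le m (H.neighborFinset m)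
      rw [card_neighborFinset_eq_degree] at h3
      have h4 := hD m
      rw [Finset.card_univ] at h2
      omega
    obtain ⟨b, hbB, hbinj⟩ := Finset.exists_nat_enumeration (B := B i) (n := p) le_rfl
    obtain ⟨c, hcB, hcinj⟩ := Finset.exists_nat_enumeration (B := B j) (n := p)
      (hmin j (Finset.mem_univ j))
    have hij : ∀ v ∈ B i, ∀ w ∈ B j, v ≠ w ∧ ¬ H.Adj v w := by
      intro v hv w hw
      refine ⟨Finset.disjoint_left.1 (hBdisj i j hji.symm) hv |>.imp (fun h => h ▸ hw), ?_⟩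
      rw [hB] at hv hw
      rw [hH, hv, hw]
      rintro ⟨-, x, hx, hx'⟩
      exact hji (hx'.symm.trans hx)
    have hpair : ∀ t < p, ∀ v ∈ ({b t, c t} : Finset V), ∀ w ∈ ({b t, c t} : Finset V),
        ¬ H.Adj v w := by
      intro t ht v hv w hw
      have := (hij _ (hbB t ht) _ (hcB t ht)).2
      simp only [Finset.mem_insert, Finset.mem_singleton] at hv hw
      rcases hv with rfl | rfl <;> rcases hw with rfl | rfl
      · exact H.irrefl
      · exact this
      · exact fun h => this h.symm
      · exact H.irrefl
    have hcard : ∀ t < p, ({b t, c t} : Finset V).card = 2 := fun t ht =>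
      Finset.card_pair (hij _ (hbB t ht) _ (hcB t ht)).1
    have hp0 : 0 < p := hBpos i
    rcases Nat.lt_or_ge 1 p with hp1 | hp1
    -- Complements of singletons meet pairwise, as there are three indices. A vertex outside `Q`
    -- omits two indices and hence misses two singleton classes, that is, at least `2p` vertices.
    · let Q : Finset V := Finset.univ.filter (fun v => ∃ k, S v = {k}ᶜ)
      have hQ : ∀ v, v ∈ Q ↔ ∃ k, S v = {k}ᶜ := fun v => by simp [Q]
      have hsQ : ∀ k, ∀ v ∈ B k, v ∉ Q := by
        intro k v hv hvQ
        rw [hB] at hv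
        obtain ⟨k', hk'⟩ := (hQ v).1 hvQ
        obtain ⟨x, hx, hx'⟩ := hother k k'
        have : x ∈ S v := by
          rw [hk']
          exact hx'
        rw [hv] at this
        exact hx this
      have hnon : ∀ k v, k ∉ S v → ∀ x ∈ B k, x ≠ v ∧ ¬ H.Adj v x := by
        intro k v hk x hx
        rw [hB] at hx
        refine ⟨?_, ?_⟩
        · rintro rfl
          exact hk (by simp [hx])
        · rw [hH, hx]
          rintro ⟨-, y, hy, rfl⟩
          exact hk hy
      have hpV : p ≤ Fintype.card V := Finset.card_le_univ _
      have := totalColorable_of_clique (G := H) (Q := Q) (F := fun t => {b t, c t}) (p := p)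
        (k := Fintype.card V + 1 - p) hp1
        (by
          intro u hu v hv huv
          obtain ⟨k, hk⟩ := (hQ u).1 hu
          obtain ⟨k', hk'⟩ := (hQ v).1 hv
          obtain ⟨x, hx, hx'⟩ := hother k k'
          rw [hH, hk, hk']
          exact ⟨huv, x, hx, hx'⟩)
        hcard
        (by
          intro t ht
          rw [Finset.disjoint_right]
          intro v hv
          simp only [Finset.mem_insert, Finset.mem_singleton] at hv
          rcases hv with rfl | rfl
          · exact hsQ i _ (hbB t ht)
          · exact hsQ j _ (hcB t ht))
        (by
          intro s hs t ht hst
          rw [Finset.disjoint_left]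
          intro v hv hv'
          simp only [Finset.mem_insert, Finset.mem_singleton] at hv hv'
          rcases hv with rfl | rfl <;> rcases hv' with h | h
          · exact hst (hbinj s hs t ht h)
          · exact (hij _ (hbB s hs) _ (hcB t ht)).1 h
          · exact (hij _ (hbB t ht) _ (hcB s hs)).1 h.symm
          · exact hst (hcinj s hs t ht h))
        hpair
        (by
          intro u hu
          obtain ⟨k, hk⟩ := (hQ u).1 hu
          obtain ⟨x, hx, -⟩ := hother k k
          obtain ⟨y, hy, hxy⟩ := hother k x
          -- Two singleton classes other than that of `k` supply the `2p` neighbors outside `Q`.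
          have hsub : ∀ z, z ≠ k → B z ⊆ H.neighborFinset u \ Q := by
            intro z hz v hv
            rw [Finset.mem_sdiff, mem_neighborFinset, hH]
            refine ⟨⟨?_, z, ?_, ?_⟩, hsQ z v hv⟩
            · rintro rfl
              exact hsQ z u hv hu
            · rw [hk]
              exact hz
            · rw [(hB z v).1 hv]
              rfl
          refine le_trans ?_ (Finset.card_le_card (Finset.union_subset (hsub x hx) (hsub y hy)))
          rw [Finset.card_union_of_disjoint (hBdisj x y hxy.symm)]
          have h2 := hmin x (Finset.mem_univ x)
          have h3 := hmin y (Finset.mem_univ y)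
          omega)
        (by
          intro v hv
          obtain ⟨k, hk⟩ := (hQ v).1 hv
          refine lt_of_le_of_lt ?_ (degree_add_card_lt H v (B k) (hnon k v (by simp [hk])))
          exact Nat.add_le_add_left (hmin k (Finset.mem_univ k)) _)
        (by
          intro v hv
          obtain ⟨k, hk⟩ := (Set.ne_univ_iff_exists_notMem _).1 (h1 v)
          obtain ⟨k', hk', hkk'⟩ : ∃ k', k' ∉ S v ∧ k ≠ k' := by
            by_contra! h
            refine hv ((hQ v).2 ⟨k, ?_⟩)
            ext x
            refine ⟨fun hx hxk => ?_, fun hx => ?_⟩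
            · rw [Set.mem_singleton_iff] at hxk
              exact hk (hxk ▸ hx)
            · by_contra hxS
              exact hx (h x hxS).symm
          refine lt_of_le_of_lt ?_ (degree_add_card_lt H v (B k ∪ B k') (fun x hx => ?_))
          · rw [Finset.card_union_of_disjoint (hBdisj k k' hkk')]
            have h2 := hmin k (Finset.mem_univ k)
            have h3 := hmin k' (Finset.mem_univ k')
            omega
          · exact (Finset.mem_union.1 hx).elim (hnon k v hk x) (hnon k' v hk' x))
        (by omega)
      exact this.mono (by omega)
    -- Here `p = 1`, so `|V| ≤ D + 2` and removing one nonadjacent pair leaves at most `D` vertices.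
    · refine totalColorable_of_independent H {b 0, c 0} (hpair 0 hp0) D hD ?_
      rw [Finset.card_compl, hcard 0 hp0]
      omega
  · push Not at hthree
    have hS : ∀ v, S v = {i} ∨ S v = {j} := by
      intro v
      obtain ⟨x, hx⟩ := Set.nonempty_iff_ne_empty.2 (h0 v)
      obtain ⟨y, hy⟩ := (Set.ne_univ_iff_exists_notMem _).1 (h1 v)
      by_cases hi : i ∈ S v
      · have hjv : j ∉ S v := by
          intro hj
          rcases eq_or_ne y i with rfl | hyi
          · exact hy hi
          · exact hy (hthree y hyi ▸ hj)
        refine Or.inl (Set.ext fun z => ⟨fun hz => ?_, fun hz => ?_⟩)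
        · by_contra hzi
          exact hjv (hthree z hzi ▸ hz)
        · rw [Set.mem_singleton_iff] at hz
          exact hz ▸ hi
      · refine Or.inr (Set.ext fun z => ⟨fun hz => hthree z ?_, fun hz => ?_⟩)
        · rintro rfl
          exact hi hz
        · rw [Set.mem_singleton_iff] at hz
          have : x = j := hthree x (by
            rintro rfl
            exact hi hx)
          exact hz ▸ this ▸ hx
    have hadj : ∀ v w, H.Adj v w → v ≠ w ∧ S v = S w := by
      intro v w h
      rw [hH] at h
      refine ⟨h.1, ?_⟩
      obtain ⟨x, hx, hx'⟩ := h.2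
      rcases hS v with h2 | h2 <;> rcases hS w with h3 | h3 <;> rw [h2] at hx ⊢ <;>
        rw [h3] at hx' ⊢ <;> rw [Set.mem_singleton_iff] at hx hx' <;> rw [← hx, ← hx']
    have hle : (B j).card ≤ D + 1 := by
      obtain ⟨v, hv⟩ := hs j
      have hvB := (hB j v).2 hv
      have h2 : (B j).erase v ⊆ H.neighborFinset v := by
        intro w hw
        obtain ⟨hwv, hw⟩ := Finset.mem_erase.1 hw
        rw [hB] at hw
        rw [mem_neighborFinset, hH, hv, hw]
        exact ⟨hwv.symm, j, rfl, rfl⟩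
      have h3 := Finset.card_le_card h2
      rw [Finset.card_erase_of_mem hvB, card_neighborFinset_eq_degree] at h3
      have h4 := hD v
      omega
    -- The graph consists of two disjoint cliques, the larger having at most `D + 1` vertices;
    -- rounding up to an odd number stays within `D + 2`.
    obtain ⟨m, hm, hmj, hmD⟩ : ∃ m, Odd m ∧ (B j).card ≤ m ∧ m ≤ D + 2 := by
      rcases Nat.even_or_odd (B j).card with he | ho
      · exact ⟨(B j).card + 1, he.add_one, by omega, by omega⟩
      · exact ⟨(B j).card, ho, le_rfl, by omega⟩
    have hmi : (B i).card ≤ m := (hmin j (Finset.mem_univ j)).trans hmj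
    obtain ⟨f, hf, hf'⟩ := (B i).exists_nat_labeling
    obtain ⟨g, hg, hg'⟩ := (B j).exists_nat_labeling
    let F : V → ℕ := fun v => if S v = {i} then f v else g v
    have hF : ∀ v w, S v = S w → F v = F w → v = w := by
      intro v w hvw h
      by_cases hv : S v = {i}
      · have hw := hvw ▸ hv
        simp only [F, hv, hw, if_pos] at h
        exact hf' v ((hB i v).2 hv) w ((hB i w).2 hw) h
      · have hvj := (hS v).resolve_left hv
        have hw : ¬ S w = {i} := hvw ▸ hv
        have hwj := (hS w).resolve_left hw
        simp only [F, hv, hw, if_false] at h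
        exact hg' v ((hB j v).2 hvj) w ((hB j w).2 hwj) h
    refine (totalColorable_of_odd (G := H) hm F (fun v => ?_) (fun v w h => ?_)
      (fun v w w' h h' => ?_)).mono hmD
    · by_cases hv : S v = {i}
      · simp only [F, hv, if_pos]
        exact (hf v ((hB i v).2 hv)).trans_le hmi
      · simp only [F, hv, if_false]
        exact (hg v ((hB j v).2 ((hS v).resolve_left hv))).trans_le hmj
    · exact fun he => (hadj v w h).1 (hF v w (hadj v w h).2 he)
    · exact hF w w' ((hadj v w h).2.symm.trans (hadj v w' h').2)

end SimpleGraph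

/-! ### Reduction of the poset to its atoms -/

namespace PosetZeroDivisor

/-- By finiteness a nonzero common lower bound has an atom below it, so atoms alone detect
adjacency. -/
theorem lowerBounds_pair_eq_iff {P : Type*} [PartialOrder P] [OrderBot P] [Finite P] (x y : P) :
    lowerBounds {x, y} = {⊥} ↔ ∀ a, IsAtom a → a ≤ x → ¬ a ≤ y := by
  constructor
  · intro h a ha hx hy
    have : a ∈ lowerBounds {x, y} := by simp [lowerBounds, hx, hy]
    rw [h] at this
    exact ha.1 this
  · intro h
    refine Set.eq_singleton_iff_unique_mem.2 ⟨by simp [lowerBounds], fun z hz => ?_⟩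
    by_contra hz0
    obtain ⟨a, ha, haz⟩ := (eq_bot_or_exists_atom_le z).resolve_left hz0
    exact h a ha (haz.trans (hz (by simp))) (haz.trans (hz (by simp)))

/-- An atom not below `x` is itself a witness that `x` is a zero-divisor. In terms of atom sets,
vertices are the elements whose set is neither empty nor full. -/
theorem mem_zeroDivisors_diff_iff {P : Type*} [PartialOrder P] [OrderBot P] [Finite P] (x : P) :
    x ∈ zeroDivisors P \ {⊥} ↔ (∃ a, IsAtom a ∧ a ≤ x) ∧ ∃ a, IsAtom a ∧ ¬ a ≤ x := by
  constructor
  · rintro ⟨⟨b, hb, h⟩, hx⟩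
    rw [lowerBounds_pair_eq_iff] at h
    obtain ⟨a, ha, hax⟩ := (eq_bot_or_exists_atom_le x).resolve_left hx
    obtain ⟨a', ha', hab⟩ := (eq_bot_or_exists_atom_le b).resolve_left hb
    exact ⟨⟨a, ha, hax⟩, a', ha', fun h' => h a' ha' h' hab⟩
  · rintro ⟨⟨a, ha, hax⟩, b, hb, hbx⟩
    refine ⟨⟨b, hb.1, ?_⟩, fun hx => ha.1 ?_⟩
    · rw [lowerBounds_pair_eq_iff]
      intro c hc hcx hcb
      obtain rfl := (hb.le_iff.1 hcb).resolve_left hc.1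
      exact hbx hcx
    · rw [Set.mem_singleton_iff] at hx
      exact le_bot_iff.1 (hx ▸ hax)

/-- In a finite `0`-distributive poset the elements not above an atom have a greatest element. -/
theorem ZeroDistributive.exists_greatest {P : Type*} [PartialOrder P] [OrderBot P] [Finite P]
    (h : ZeroDistributive P) {a : P} (ha : IsAtom a) : ∃ m, ¬ a ≤ m ∧ ∀ x, ¬ a ≤ x → x ≤ m := by
  obtain ⟨m, hm⟩ := (Set.toFinite {x : P | ¬ a ≤ x}).exists_maximal
    ⟨⊥, fun h => ha.1 (le_bot_iff.1 h)⟩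
  refine ⟨m, hm.1, fun x hx => ?_⟩
  have hl : ∀ y, ¬ a ≤ y → lowerBounds {a, y} = {⊥} := by
    intro y hy
    rw [lowerBounds_pair_eq_iff]
    intro b hb hba hby
    obtain rfl := (ha.le_iff.1 hba).resolve_left hb.1
    exact hy hby
  -- By `0`-distributivity `m` and `x` have a common upper bound not above `a`; maximality of `m`
  -- puts it below `m`.
  have hax : a ∉ lowerBounds ({a} ∪ upperBounds {m, x}) := by
    rw [h a m x (hl m hm.1) (hl x hx)]
    exact ha.1
  obtain ⟨d, hd, had⟩ : ∃ d ∈ upperBounds {m, x}, ¬ a ≤ d := by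
    by_contra! hall
    refine hax fun d hd => ?_
    rcases hd with hd | hd
    · exact le_of_eq hd.symm
    · exact hall d hd
  have hmd : m ≤ d := hd (by simp)
  exact (hd (by simp)).trans (hm.2 had hmd)

end PosetZeroDivisor

theorem theorem1p2 (P : Type*) [PartialOrder P] [OrderBot P] [Finite P] :
    (PosetZeroDivisor.zeroDivisorGraph P).SatisfiesTotalColoringConjecture ∧
      (PosetZeroDivisor.ZeroDistributive P →
        (PosetZeroDivisor.zeroDivisorGraph P)ᶜ.SatisfiesTotalColoringConjecture) := by
  classical
  have hadj : ∀ v w, (PosetZeroDivisor.zeroDivisorGraph P).Adj v w ↔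
      ∀ a, IsAtom a → a ≤ (v : P) → ¬ a ≤ (w : P) := fun v w =>
    PosetZeroDivisor.lowerBounds_pair_eq_iff (v : P) w
  have hv : ∀ v : PosetZeroDivisor.Vertex P,
      (∃ a, IsAtom a ∧ a ≤ (v : P)) ∧ ∃ a, IsAtom a ∧ ¬ a ≤ (v : P) := fun v =>
    (PosetZeroDivisor.mem_zeroDivisors_diff_iff (v : P)).1 v.2
  have hatom : ∀ a b : P, IsAtom a → IsAtom b → a ≠ b → ¬ a ≤ b := fun a b ha hb hab h =>
    hab ((hb.le_iff.1 h).resolve_left ha.1)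
  have hFV : Fintype (PosetZeroDivisor.Vertex P) := Fintype.ofFinite _
  have hFP : Fintype P := Fintype.ofFinite _
  rcases isEmpty_or_nonempty (PosetZeroDivisor.Vertex P) with hV | ⟨⟨x⟩⟩
  · have hE : ∀ G : SimpleGraph (PosetZeroDivisor.Vertex P),
        G.SatisfiesTotalColoringConjecture := fun G =>
      (SimpleGraph.totalColorable_of_independent G Finset.univ (fun v => hV.elim v)
        G.finiteMaxDegree (fun v => hV.elim v) (by simp)).satisfiesTotalColoringConjecture
    exact ⟨hE _, fun _ => hE _⟩
  obtain ⟨⟨a₁, ha₁, hx₁⟩, a₂, ha₂, hx₂⟩ := hv x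
  have hne : ∀ a : P, ∃ b, IsAtom b ∧ b ≠ a := by
    intro a
    by_cases h : a₁ = a
    · refine ⟨a₂, ha₂, ?_⟩
      rintro rfl
      exact hx₂ (h ▸ hx₁)
    · exact ⟨a₁, ha₁, h⟩
  have hav : ∀ a : P, IsAtom a → a ∈ PosetZeroDivisor.zeroDivisors P \ {⊥} := by
    intro a ha
    obtain ⟨b, hb, hba⟩ := hne a
    exact (PosetZeroDivisor.mem_zeroDivisors_diff_iff a).2
      ⟨⟨a, ha, le_rfl⟩, b, hb, hatom b a hb ha hba⟩
  refine ⟨SimpleGraph.TotalColorable.satisfiesTotalColoringConjecture ?_, fun hdist =>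
    SimpleGraph.TotalColorable.satisfiesTotalColoringConjecture ?_⟩
  -- Elements above `a₁` share that atom and are independent; all other vertices are neighbors of
  -- `a₁`, so their number is at most its degree.
  · refine SimpleGraph.totalColorable_of_independent _
      (Finset.univ.filter (fun v : PosetZeroDivisor.Vertex P => a₁ ≤ (v : P)))
      (fun v hv w hw h => ?_) _ (SimpleGraph.degree_le_finiteMaxDegree _) ?_
    · exact (hadj v w).1 h a₁ ha₁ (Finset.mem_filter.1 hv).2 (Finset.mem_filter.1 hw).2
    · refine le_trans ?_ (SimpleGraph.degree_le_finiteMaxDegree _ ⟨a₁, hav a₁ ha₁⟩)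
      rw [← SimpleGraph.card_neighborFinset_eq_degree]
      refine Finset.card_le_card fun w hw => ?_
      rw [SimpleGraph.mem_neighborFinset, hadj]
      intro b hb hba
      obtain rfl := (ha₁.le_iff.1 hba).resolve_left hb.1
      simpa using hw
  · refine SimpleGraph.totalColorable_of_intersection (ι := {a : P // IsAtom a})
      (fun v : PosetZeroDivisor.Vertex P => {a | (a : P) ≤ (v : P)}) (fun v w => ?_)
      (fun v h => ?_) (fun v h => ?_) (fun i => ⟨⟨i, hav i i.2⟩, ?_⟩) (fun i => ?_) _
      (SimpleGraph.degree_le_finiteMaxDegree _)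
    · rw [SimpleGraph.compl_adj, hadj]
      refine and_congr_right fun _ => ?_
      push Not
      exact ⟨fun ⟨a, ha, h, h'⟩ => ⟨⟨a, ha⟩, h, h'⟩, fun ⟨a, h, h'⟩ => ⟨a.1, a.2, h, h'⟩⟩
    · obtain ⟨a, ha, h'⟩ := (hv v).1
      exact Set.eq_empty_iff_forall_notMem.1 h ⟨a, ha⟩ h'
    · obtain ⟨a, ha, h'⟩ := (hv v).2
      exact h' (Set.eq_univ_iff_forall.1 h ⟨a, ha⟩)
    · ext a
      refine ⟨fun h => ?_, fun h => ?_⟩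
      · exact Subtype.ext ((i.2.le_iff.1 h).resolve_left a.2.1)
      · rw [Set.mem_singleton_iff] at h
        subst h
        exact le_refl (a : P)
    -- The greatest element not above the atom `i` lies above all other atoms, so its atom set is
    -- the complement of `{i}`.
    · obtain ⟨m, hm, hmax⟩ := hdist.exists_greatest i.2
      have hle : ∀ a : P, IsAtom a → a ≠ i → a ≤ m := fun a ha h =>
        hmax a (hatom i a i.2 ha h.symm)
      obtain ⟨b, hb, hbi⟩ := hne i
      refine ⟨⟨m, (PosetZeroDivisor.mem_zeroDivisors_diff_iff m).2
        ⟨⟨b, hb, hle b hb hbi⟩, i, i.2, hm⟩⟩, Set.ext fun a => ⟨fun h h' => ?_, fun h => ?_⟩⟩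
      · rw [Set.mem_singleton_iff] at h'
        subst h'
        exact hm h
      · exact hle a a.2 fun h' => h (Subtype.ext h')
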